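/- **Conventions.** Let $T>0$. A *locally bounded Borel measure* on $X=\mathbb{R}^d$ or $X=\mathbb{R}^d\times[0,T]$ is a real (possibly signed) function on the bounded Borel subsets of $X$ that is countably additive on the Borel subsets of every compact set; $|\mu|$ denotes its total variation. Such a measure $\mu$ on $\mathbb{R}^d\times[0,T]$ is *given by a family* $(\mu_t)_{t\in[0,T]}$ of locally bounded Borel measures on $\mathbb{R}^d$, written $\mu=\mu_t(dx)\,dt$, if $t\mapsto\mu_t(B)$ is measurable for every bounded Borel set $B\subset\mathbb{R}^d$, $t\mapsto|\mu_t|(K)$ is in $L^1[0,T]$ for every compact $K\subset\mathbb{R}^d$, and $\int u\,d\mu=\int_0^T\int_{\mathbb{R}^d}u(x,t)\,\mu_t(dx)\,dt$ for every bounded Borel function $u$ that vanishes for $x$ outside a ball. Let $b\colon\mathbb{R}^d\times[0,T]\to\mathbb{R}^d$ be a vector field and let $\nu$ be a locally bounded Borel measure on $\mathbb{R}^d$. A measure $\mu=\mu_t(dx)\,dt$ as above is a *solution of the Cauchy problem* $\partial_t\mu+\mathrm{div}(b\mu)=0$, $\mu|_{t=0}=\nu$, if $b\in L^1(|\mu|,U\times[0,T])$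 for every ball $U\subset\mathbb{R}^d$ and, for every function $u$ that is continuous on $\mathbb{R}^d\times[0,T)$ along with its first order derivatives in $t$ and $x$ and satisfies $u(x,t)=0$ for $|x|>R$ for some $R$, one has $$\int_{\mathbb{R}^d}u(x,t)\,\mu_t(dx)=\int_{\mathbb{R}^d}u(x,0)\,\nu(dx)+\int_0^t\int_{\mathbb{R}^d}\bigl[\partial_tu+\langle b,\nabla u\rangle\bigr]\,\mu_s(dx)\,ds$$ for almost every $t\in[0,T]$. **Theorem.** Let $\mu^1=\mu^1_t(dx)\,dt$ and $\mu^2=\mu^2_t(dx)\,dt$ be two solutions of the same Cauchy problem, and put $\mu_t=\mu^1_t-\mu^2_t$. Assume that there is a number $C_1\ge 0$ such that for every ball $U\subset\mathbb{R}^d$ there exist a number $C_2\ge 0$, vector fields $b_k\in C^\infty(\mathbb{R}^d\times\mathbb{R},\mathbb{R}^d)$ and positive functions $V_k\in C^1(\mathbb{R}^d)$, $k\in\mathbb{N}$ (all allowed to depend on $\mu$, $C_1$ and $U$), such that (i) $|b_k(x,t)|\le C_1+C_1|x|$ for all $k$, $x\in\mathbb{R}^d$, $t\in[0,T]$; (ii)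 $\inf_k\inf_U V_k>0$, and, with $\mathcal{B}_k=(\partial_{x_i}b_k^j)_{i,j\le d}$, $$\langle b_k(x,t),\nabla V_k(x)\rangle\le\Bigl(C_2-2\max_{|\xi|=1}\langle\mathcal{B}_k(x,t)\xi,\xi\rangle\Bigr)V_k(x)\quad\text{for all }k\text{ and }(x,t)\in U\times[0,T];$$ (iii) $\displaystyle\lim_{k\to\infty}\int_0^T\int_U|b_k(x,t)-b(x,t)|\sqrt{V_k(x)}\,|\mu_t|(dx)\,dt=0$. Then $\mu^1=\mu^2$; equivalently, $\mu^1_t=\mu^2_t$ for almost every $t\in[0,T]$. -/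

import Mathlib

open MeasureTheory Set Filter Topology
open scoped ENNReal ContDiff

namespace ContinuityEq

/-- A locally bounded (signed) Borel measure: a real function on the bounded Borel sets that is
countably additive on the Borel subsets of every compact set. (Sets that are not bounded Borel sets
get the value `0`, so that two such objects are equal iff they agree on all bounded Borel sets.) -/
structure LocMeasure (X : Type*) [MetricSpace X] [MeasurableSpace X] where
  /-- the value on a set -/
  toFun : Set X → ℝ
  eq_zero' : ∀ A : Set X, ¬ (MeasurableSet A ∧ Bornology.IsBounded A) → toFun A = 0
  hasSum' : ∀ K : Set X, IsCompact K → ∀ A : ℕ → Set X, (∀ i, MeasurableSet (A i)) →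
    (∀ i, A i ⊆ K) → Pairwise (Function.onFun Disjoint A) →
    HasSum (fun i => toFun (A i)) (toFun (⋃ i, A i))

namespace LocMeasure

instance {X : Type*} [MetricSpace X] [MeasurableSpace X] :
    CoeFun (LocMeasure X) (fun _ => Set X → ℝ) := ⟨toFun⟩

@[ext]
theorem ext {X : Type*} [MetricSpace X] [MeasurableSpace X] {μ₁ μ₂ : LocMeasure X}
    (h : ∀ A, MeasurableSet A → Bornology.IsBounded A → μ₁ A = μ₂ A) : μ₁ = μ₂ := by
  have hfun : μ₁.toFun = μ₂.toFun := by
    funext A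
    by_cases hA : MeasurableSet A ∧ Bornology.IsBounded A
    · exact h A hA.1 hA.2
    · rw [μ₁.eq_zero' A hA, μ₂.eq_zero' A hA]
  cases μ₁
  cases μ₂
  cases hfun
  rfl

instance {X : Type*} [MetricSpace X] [MeasurableSpace X] : Sub (LocMeasure X) where
  sub μ₁ μ₂ :=
    { toFun := fun A => μ₁ A - μ₂ A
      eq_zero' := fun A hA => by rw [μ₁.eq_zero' A hA, μ₂.eq_zero' A hA, sub_zero]
      hasSum' := fun K hK A hA hAK hd =>
        (μ₁.hasSum' K hK A hA hAK hd).sub (μ₂.hasSum' K hK A hA hAK hd) }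

theorem sub_apply {X : Type*} [MetricSpace X] [MeasurableSpace X] (μ₁ μ₂ : LocMeasure X)
    (A : Set X) : (μ₁ - μ₂) A = μ₁ A - μ₂ A := rfl

theorem apply_empty {X : Type*} [MetricSpace X] [MeasurableSpace X] (μ : LocMeasure X) :
    μ ∅ = 0 := by
  have h := μ.hasSum' ∅ isCompact_empty (fun _ => ∅) (fun _ => MeasurableSet.empty)
    (fun _ => Subset.rfl) (fun _ _ _ => disjoint_bot_left)
  rw [iUnion_empty] at h
  exact ((summable_const_iff _).1 h.summable)

open Classical in
/-- The finite signed measure `A ↦ μ (A ∩ D)`, for a Borel set `D` contained in a compact set. -/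
noncomputable def restrict {X : Type*} [MetricSpace X] [MeasurableSpace X] (μ : LocMeasure X)
    (D : Set X) (hD : MeasurableSet D) (hc : ∃ K, IsCompact K ∧ D ⊆ K) : SignedMeasure X where
  measureOf' A := if MeasurableSet A then μ (A ∩ D) else 0
  empty' := by simp [apply_empty]
  not_measurable' _ hA := if_neg hA
  m_iUnion' A hA hd := by
    obtain ⟨K, hK, hDK⟩ := hc
    have h := μ.hasSum' K hK (fun i => A i ∩ D) (fun i => (hA i).inter hD)
      (fun i => inter_subset_right.trans hDK)
      (fun i j hij => (hd hij).mono inter_subset_left inter_subset_left)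
    simp only [hA, MeasurableSet.iUnion hA, if_true, iUnion_inter]
    exact h

/-- A partition of `X` into countably many disjoint Borel sets, each contained in a compact set,
such that every compact set meets only finitely many of them: the successive differences of a
compact exhaustion of `X`. -/
noncomputable def piece (X : Type*) [MetricSpace X] [ProperSpace X] (n : ℕ) : Set X := disjointed (CompactExhaustion.choice X) n

theorem piece_subset_isCompact {X : Type*} [MetricSpace X] [ProperSpace X] (n : ℕ) : ∃ K, IsCompact K ∧ piece X n ⊆ K :=
  ⟨_, (CompactExhaustion.choice X).isCompact n, disjointed_subset _ n⟩

section Parts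

variable {X : Type*} [MetricSpace X] [ProperSpace X] [MeasurableSpace X] [BorelSpace X]

theorem measurableSet_piece (n : ℕ) : MeasurableSet (piece X n) :=
  MeasurableSet.disjointed
    (fun i => ((CompactExhaustion.choice X).isCompact i).isClosed.measurableSet) n

/-- The Jordan decomposition of the restriction of `μ` to the `n`-th piece. -/
noncomputable def jordanPiece (μ : LocMeasure X) (n : ℕ) : JordanDecomposition X :=
  (μ.restrict (piece X n) (measurableSet_piece n) (piece_subset_isCompact n)).toJordanDecomposition

/-- The positive part `μ⁺` of `μ`, a (possibly infinite) nonnegative Borel measure that is finite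
on bounded sets, glued from the positive parts of the restrictions of `μ` to the pieces. -/
noncomputable def posPart (μ : LocMeasure X) : Measure X :=
  Measure.sum fun n => (μ.jordanPiece n).posPart

/-- The negative part `μ⁻` of `μ`. -/
noncomputable def negPart (μ : LocMeasure X) : Measure X :=
  Measure.sum fun n => (μ.jordanPiece n).negPart

/-- The total variation `|μ| = μ⁺ + μ⁻`. -/
noncomputable def variation (μ : LocMeasure X) : Measure X := μ.posPart + μ.negPart

/-- The integral `∫ u dμ = ∫ u dμ⁺ - ∫ u dμ⁻` (meaningful for `u ∈ L¹(|μ|)`). -/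
noncomputable def integral (μ : LocMeasure X) (u : X → ℝ) : ℝ :=
  (∫ x, u x ∂μ.posPart) - ∫ x, u x ∂μ.negPart

end Parts

end LocMeasure

/-- The locally bounded Borel measure `M` on `ℝᵈ × [0, T]` is given by the family `(μ t)`,
`t ∈ [0, T]`, of locally bounded Borel measures on `ℝᵈ`, i.e. `M = μ_t(dx) dt`. -/
structure IsGivenBy {d : ℕ} (T : ℝ) (M : LocMeasure (EuclideanSpace ℝ (Fin d) × Icc (0 : ℝ) T))
    (μ : ℝ → LocMeasure (EuclideanSpace ℝ (Fin d))) : Prop where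
  /-- `t ↦ μ_t(B)` is (Lebesgue) measurable on `[0, T]` for every bounded Borel set `B` -/
  measurable : ∀ B : Set (EuclideanSpace ℝ (Fin d)), MeasurableSet B → Bornology.IsBounded B →
    AEMeasurable (fun t => μ t B) (volume.restrict (Icc 0 T))
  /-- `|μ_t|(K) ∈ L¹[0, T]` for every compact set `K` -/
  integrable : ∀ K : Set (EuclideanSpace ℝ (Fin d)), IsCompact K →
    IntegrableOn (fun t => (μ t).variation.real K) (Icc 0 T) volume
  /-- `∫ u dM = ∫₀ᵀ ∫ u(x, t) μ_t(dx) dt` for every bounded Borel function `u` that vanishes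
  for `x` outside a ball -/
  integral_eq : ∀ u : EuclideanSpace ℝ (Fin d) × ℝ → ℝ, Measurable u →
    (∃ C, ∀ p, |u p| ≤ C) → (∃ R, ∀ x t, R < ‖x‖ → u (x, t) = 0) →
    M.integral (fun p => u (p.1, (p.2 : ℝ))) =
      ∫ t in Icc 0 T, (μ t).integral (fun x => u (x, t))

/-- `u` belongs to the class `C^{1,1}(ℝᵈ × [0, T))` (continuous on `ℝᵈ × [0, T)` along with its
first order derivatives in `t` and `x`), with `∂ₜu = ut` and `∇ₓu = gu` (the derivative in `t` is
one-sided at `t = 0`), and `u(x, t) = 0` for `|x| > R`, for some `R`. -/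
structure IsTestFunction {d : ℕ} (T : ℝ) (u : EuclideanSpace ℝ (Fin d) → ℝ → ℝ)
    (ut : EuclideanSpace ℝ (Fin d) → ℝ → ℝ)
    (gu : EuclideanSpace ℝ (Fin d) → ℝ → EuclideanSpace ℝ (Fin d)) : Prop where
  hasDerivWithinAt : ∀ x, ∀ t ∈ Ico 0 T, HasDerivWithinAt (u x) (ut x t) (Ico 0 T) t
  hasGradientAt : ∀ x, ∀ t ∈ Ico 0 T, HasGradientAt (fun y => u y t) (gu x t) x
  continuousOn : ContinuousOn (fun p : EuclideanSpace ℝ (Fin d) × ℝ => u p.1 p.2)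
    (univ ×ˢ Ico 0 T)
  continuousOn_deriv : ContinuousOn (fun p : EuclideanSpace ℝ (Fin d) × ℝ => ut p.1 p.2)
    (univ ×ˢ Ico 0 T)
  continuousOn_gradient : ContinuousOn (fun p : EuclideanSpace ℝ (Fin d) × ℝ => gu p.1 p.2)
    (univ ×ˢ Ico 0 T)
  eq_zero : ∃ R, ∀ x, ∀ t ∈ Ico 0 T, R < ‖x‖ → u x t = 0

/-- The measure `M = μ_t(dx) dt` on `ℝᵈ × [0, T]` is a solution of the Cauchy problem
`∂ₜμ + div(bμ) = 0`, `μ|_{t = 0} = ν`. -/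
structure IsSolution {d : ℕ} (T : ℝ) (b : EuclideanSpace ℝ (Fin d) → ℝ → EuclideanSpace ℝ (Fin d))
    (ν : LocMeasure (EuclideanSpace ℝ (Fin d)))
    (M : LocMeasure (EuclideanSpace ℝ (Fin d) × Icc (0 : ℝ) T))
    (μ : ℝ → LocMeasure (EuclideanSpace ℝ (Fin d))) : Prop where
  isGivenBy : IsGivenBy T M μ
  /-- `b ∈ L¹(|M|, U × [0, T])` for every ball `U` -/
  integrableOn : ∀ (z : EuclideanSpace ℝ (Fin d)) (r : ℝ),
    IntegrableOn (fun p : EuclideanSpace ℝ (Fin d) × Icc (0 : ℝ) T => b p.1 p.2)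
      (Metric.ball z r ×ˢ univ) M.variation
  /-- the integral identity against test functions -/
  integral_eq : ∀ u ut gu, IsTestFunction T u ut gu →
    ∀ᵐ t ∂(volume.restrict (Icc 0 T)),
      (μ t).integral (fun x => u x t) = ν.integral (fun x => u x 0) +
        ∫ s in (0 : ℝ)..t, (μ s).integral (fun x => ut x s + inner ℝ (b x s) (gu x s))

/-- `max_{|ξ| = 1} ⟨𝓑(x, t)ξ, ξ⟩`, where `𝓑(x, t) = (∂_{x_i} h^j(x, t))_{i,j}` is the Jacobian matrix
in `x` of the field `h`. (Transposing the matrix does not change the quadratic form.) -/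
noncomputable def maxJacobianForm {d : ℕ}
    (h : EuclideanSpace ℝ (Fin d) → ℝ → EuclideanSpace ℝ (Fin d))
    (x : EuclideanSpace ℝ (Fin d)) (t : ℝ) : ℝ :=
  ⨆ ξ : Metric.sphere (0 : EuclideanSpace ℝ (Fin d)) 1,
    inner ℝ (fderiv ℝ (fun y => h y t) x (ξ : EuclideanSpace ℝ (Fin d)))
      (ξ : EuclideanSpace ℝ (Fin d))

end ContinuityEq

/-! The proof is Holmgren's duality argument. Fix a smooth compactly supported `ψ` and a final time
`t₀`, and solve the backward transport equation `∂ₛu + ⟨b_k, ∇u⟩ = 0`, `u(·, t₀) = ψ`, by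
characteristics: `u(x, s)` is the value of `ψ` at the time-`t₀` position of the trajectory of `b_k`
that starts from `x` at time `s`. In the identity for `μ = μ¹ - μ²` the initial terms cancel, and
testing with `u` leaves `∫ ψ dμ_{t₀} = ∫₀^{t₀} ∫ ⟨b - b_k, ∇u⟩ dμ_s ds`.

Two bounds uniform in `k` make the right side vanish in the limit. By (i) and Grönwall, a trajectory
that ends in the ball of radius `R` containing the support of `ψ` never leaves a ball `U` whose
radius depends only on `R`, `C₁`, `T`; so `u` is supported in `U`, and `U` is fixed before `C₂`,
`b_k`, `V_k` are chosen. By (ii), if `w` is the derivative of the flow in a spatial direction, then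
`|w|² V_k` grows along a trajectory at most like `exp (C₂ σ)`: the growth `2⟨𝓑w, w⟩` of `|w|²` is
absorbed by the Jacobian term of (ii). As `V_k ≥ c` at the end point, `|∇u| ≤ const · √V_k` on `U`,
and (iii) concludes. The main steps are `exists_transport_solution`, `IsSolution.integral_sub_eq`
and `IsSolution.enorm_integral_sub_le`.

Three technical points shape the rest. Admissible `u` must be `C¹` jointly in `(x, t)`, so the flow
is shown to be `C¹` by linearization. The identity holds only for almost every `t`, with a null set
depending on `u`; hence rational final times slightly larger than `t` are used, with `u(·, t)` close
to `ψ`. Finally, to subtract the two identities one needs `b(·, t)` to be integrable against almost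
every `|μⁱ_t|`, which is obtained by disintegrating the parts of `Mᵢ` into kernels and comparing
them with `μⁱ_t`. -/

namespace ContinuityEq

open scoped NNReal

/-! ### Global flows of bounded Lipschitz fields and their linearization -/

section Flow

variable {Z : Type*} [NormedAddCommGroup Z] [NormedSpace ℝ Z]

/-- `Φ` is the global flow of the autonomous vector field `F`. -/
structure IsFlowOf (F : Z → Z) (Φ : ℝ → Z → Z) : Prop where
  map_zero : ∀ z, Φ 0 z = z
  hasDerivAt : ∀ z σ, HasDerivAt (fun σ => Φ σ z) (F (Φ σ z)) σ

/-- Since `F` is bounded by `L` everywhere, Picard–Lindelöf applies on every interval `[-(n+1),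
n+1]` with a ball of radius `L(n+1)`. By uniqueness the local solutions agree on overlaps and can be
glued. -/
theorem exists_integralCurve [CompleteSpace Z] {F : Z → Z} {K L : ℝ≥0} (hF : LipschitzWith K F)
    (hL : ∀ x, ‖F x‖ ≤ L) (z : Z) : ∃ γ : ℝ → Z, γ 0 = z ∧ ∀ σ, HasDerivAt γ (F (γ σ)) σ := by
  have hloc : ∀ n : ℕ, ∃ α : ℝ → Z, α 0 = z ∧
      ∀ t ∈ Ioo (-((n : ℝ) + 1)) (n + 1), HasDerivAt α (F (α t)) t := by
    intro n
    have h0 : (0 : ℝ) ∈ Icc (-((n : ℝ) + 1)) (n + 1) := ⟨by linarith, by positivity⟩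
    have hP : IsPicardLindelof (fun _ => F) (⟨0, h0⟩ : Icc (-((n : ℝ) + 1)) (n + 1)) z
        (L * (n + 1)) 0 L K :=
      { lipschitzOnWith := fun _ _ => hF.lipschitzOnWith
        continuousOn := fun _ _ => continuousOn_const
        norm_le := fun _ _ x _ => hL x
        mul_max_le := by simp }
    obtain ⟨α, h1, h2⟩ := hP.exists_eq_forall_mem_Icc_hasDerivWithinAt₀
    exact ⟨α, h1, fun t ht => (h2 t (Ioo_subset_Icc_self ht)).hasDerivAt (Icc_mem_nhds ht.1 ht.2)⟩
  choose α hα0 hα using hloc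
  have hagree : ∀ m n : ℕ, ∀ s : ℝ, |s| < m + 1 → |s| < n + 1 → α m s = α n s := by
    have key : ∀ m n : ℕ, m ≤ n → ∀ s : ℝ, |s| < m + 1 → α m s = α n s := by
      intro m n hmn s hs
      have hmn' : (m : ℝ) ≤ n := by exact_mod_cast hmn
      refine ODE_solution_unique_of_mem_Ioo (v := fun _ => F) (s := fun _ => univ)
        (a := -((m : ℝ) + 1)) (b := m + 1) (t₀ := 0) (K := K)
        (fun _ _ => hF.lipschitzOnWith) ⟨by linarith, by positivity⟩
        (fun t ht => ⟨hα m t ht, trivial⟩)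
        (fun t ht => ⟨hα n t ⟨by linarith [ht.1], by linarith [ht.2]⟩, trivial⟩)
        (by rw [hα0, hα0]) (abs_lt.1 hs)
    intro m n s hm hn
    rcases le_total m n with h | h
    · exact key m n h s hm
    · exact (key n m h s hn).symm
  -- The index varies with `s`, but near `σ` it may be frozen at `⌈|σ|⌉₊` by the agreement of the
  -- local solutions.
  refine ⟨fun s => α ⌈|s|⌉₊ s, hα0 _, fun σ => ?_⟩
  have hlt : ∀ s : ℝ, |s| < (⌈|s|⌉₊ : ℝ) + 1 := fun s => (Nat.le_ceil _).trans_lt (lt_add_one _)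
  have hev : (fun s => α ⌈|s|⌉₊ s) =ᶠ[𝓝 σ] α ⌈|σ|⌉₊ := by
    filter_upwards [(continuous_abs.tendsto σ).eventually_lt_const (hlt σ)] with s hs
    exact hagree _ _ s (hlt s) hs
  exact (hα ⌈|σ|⌉₊ σ (abs_lt.1 (hlt σ))).congr_of_eventuallyEq hev

theorem exists_isFlowOf [CompleteSpace Z] {F : Z → Z} {K L : ℝ≥0} (hF : LipschitzWith K F)
    (hL : ∀ x, ‖F x‖ ≤ L) : ∃ Φ : ℝ → Z → Z, IsFlowOf F Φ := by
  choose γ h0 hγ using exists_integralCurve hF hL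
  exact ⟨fun σ z => γ z σ, h0, hγ⟩

namespace IsFlowOf

variable {F : Z → Z} {Φ : ℝ → Z → Z} {K K₂ : ℝ≥0}

theorem map_add (hΦ : IsFlowOf F Φ) (hF : LipschitzWith K F) (σ τ : ℝ) (z : Z) :
    Φ (σ + τ) z = Φ σ (Φ τ z) := by
  have h := ODE_solution_unique_univ (v := fun _ => F) (s := fun _ => univ) (t₀ := 0) (K := K)
    (f := fun σ => Φ (σ + τ) z) (g := fun σ => Φ σ (Φ τ z)) (fun _ => hF.lipschitzOnWith)
    (fun t => ⟨(hΦ.hasDerivAt z (t + τ)).comp_add_const t τ, trivial⟩)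
    (fun t => ⟨hΦ.hasDerivAt _ t, trivial⟩) (by simp [hΦ.map_zero])
  exact congrFun h σ

/-- Time reversal: Grönwall estimates are proved for nonnegative times and transferred to negative
ones through `-F`. -/
theorem neg (hΦ : IsFlowOf F Φ) : IsFlowOf (fun z => -F z) (fun σ => Φ (-σ)) where
  map_zero z := by simp [hΦ.map_zero]
  hasDerivAt z σ := by
    have := (hΦ.hasDerivAt z (-σ)).scomp σ (hasDerivAt_neg σ)
    simpa [Function.comp_def] using this

theorem continuous_time (hΦ : IsFlowOf F Φ) (z : Z) : Continuous fun σ => Φ σ z :=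
  continuous_iff_continuousAt.2 fun σ => (hΦ.hasDerivAt z σ).continuousAt

theorem norm_sub_le_of_nonneg (hΦ : IsFlowOf F Φ) (hF : LipschitzWith K F) (z w : Z) {σ : ℝ}
    (hσ : 0 ≤ σ) : ‖Φ σ z - Φ σ w‖ ≤ ‖z - w‖ * Real.exp (K * σ) := by
  have h := dist_le_of_trajectories_ODE (v := fun _ => F) (K := K) (a := 0) (b := σ)
    (f := fun σ => Φ σ z) (g := fun σ => Φ σ w) (δ := ‖z - w‖) (fun _ => hF)
    (hΦ.continuous_time z).continuousOn (fun t _ => (hΦ.hasDerivAt z t).hasDerivWithinAt)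
    (hΦ.continuous_time w).continuousOn (fun t _ => (hΦ.hasDerivAt w t).hasDerivWithinAt)
    (by simp [hΦ.map_zero, dist_eq_norm]) σ ⟨hσ, le_rfl⟩
  simpa [dist_eq_norm] using h

theorem norm_sub_le (hΦ : IsFlowOf F Φ) (hF : LipschitzWith K F) (z w : Z) (σ : ℝ) :
    ‖Φ σ z - Φ σ w‖ ≤ ‖z - w‖ * Real.exp (K * |σ|) := by
  rcases le_total 0 σ with h | h
  · rw [abs_of_nonneg h]; exact hΦ.norm_sub_le_of_nonneg hF z w h
  · rw [abs_of_nonpos h]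
    have := hΦ.neg.norm_sub_le_of_nonneg (K := K) hF.neg z w (σ := -σ)
      (by linarith)
    simpa using this

end IsFlowOf

/-- `Y` solves the linearization `Y' = F'(Φ_t z) ∘ Y`, `Y 0 = 1`, of the flow on `[-h, h]`. -/
structure IsLinearizedFlow (F : Z → Z) (Φ : ℝ → Z → Z) (h : ℝ) (z : Z) (Y : ℝ → Z →L[ℝ] Z) :
    Prop where
  map_zero : Y 0 = ContinuousLinearMap.id ℝ Z
  hasDerivWithinAt : ∀ t ∈ Icc (-h) h,
    HasDerivWithinAt Y ((fderiv ℝ F (Φ t z)).comp (Y t)) (Icc (-h) h) t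

/-- Mean value inequality on the ball of radius `‖y - x‖`, where the derivative differs from its
value at `x` by at most `K₂ ‖y - x‖`. The sharp factor `1/2` is not needed. -/
theorem norm_sub_sub_fderiv_le {F : Z → Z} {K₂ : ℝ≥0} (hd : Differentiable ℝ F)
    (hF' : LipschitzWith K₂ (fderiv ℝ F)) (x y : Z) :
    ‖F y - F x - fderiv ℝ F x (y - x)‖ ≤ K₂ * ‖y - x‖ ^ 2 := by
  have := (convex_closedBall x ‖y - x‖).norm_image_sub_le_of_norm_fderiv_le' (𝕜 := ℝ) (f := F)
    (φ := fderiv ℝ F x) (C := K₂ * ‖y - x‖) (fun w _ => hd w)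
    (fun w hw => by
      have h1 := hF'.dist_le_mul w x
      rw [dist_eq_norm, dist_eq_norm] at h1
      refine h1.trans ?_
      gcongr
      simpa [dist_eq_norm] using hw)
    (x := x) (y := y) (by simp) (by simp [dist_eq_norm])
  calc _ ≤ _ := this
    _ = _ := by ring

theorem lipschitzWith_fderiv_neg {F : Z → Z} {K₂ : ℝ≥0} (hF' : LipschitzWith K₂ (fderiv ℝ F)) :
    LipschitzWith K₂ (fderiv ℝ fun z => -F z) := by
  have : (fderiv ℝ fun z => -F z) = -fderiv ℝ F := by
    funext z; simp [fderiv_fun_neg]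
  rw [this]
  exact hF'.neg

namespace IsLinearizedFlow

variable {F : Z → Z} {Φ : ℝ → Z → Z} {K K₂ : ℝ≥0} {h : ℝ} {z w : Z} {Y Y' : ℝ → Z →L[ℝ] Z}

theorem neg (hY : IsLinearizedFlow F Φ h z Y) :
    IsLinearizedFlow (fun z => -F z) (fun σ => Φ (-σ)) h z (fun σ => Y (-σ)) where
  map_zero := by simp [hY.map_zero]
  hasDerivWithinAt t ht := by
    have ht' : -t ∈ Icc (-h) h := ⟨by linarith [ht.2], by linarith [ht.1]⟩
    have := (hY.hasDerivWithinAt (-t) ht').scomp t (hasDerivAt_neg t).hasDerivWithinAt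
      (s := Icc (-h) h) (fun s hs => ⟨by linarith [hs.2], by linarith [hs.1]⟩)
    simpa [Function.comp_def, fderiv_fun_neg] using this

theorem hasDerivAt (hY : IsLinearizedFlow F Φ h z Y) {t : ℝ} (ht : t ∈ Ioo (-h) h) :
    HasDerivAt Y ((fderiv ℝ F (Φ t z)).comp (Y t)) t :=
  (hY.hasDerivWithinAt t (Ioo_subset_Icc_self ht)).hasDerivAt (Icc_mem_nhds ht.1 ht.2)

theorem continuousOn (hY : IsLinearizedFlow F Φ h z Y) : ContinuousOn Y (Icc (-h) h) :=
  fun t ht => (hY.hasDerivWithinAt t ht).continuousWithinAt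

theorem norm_le_of_nonneg (hY : IsLinearizedFlow F Φ h z Y) (hF : LipschitzWith K F) (hh : 0 < h)
    {t : ℝ} (ht : t ∈ Icc 0 h) : ‖Y t‖ ≤ Real.exp (K * h) := by
  have := norm_le_gronwallBound_of_norm_deriv_right_le (f := Y) (δ := 1) (K := K) (ε := 0)
    (hY.continuousOn.mono (Icc_subset_Icc_left (by linarith)))
    (fun t ht => (hY.hasDerivAt ⟨by linarith [ht.1], ht.2⟩).hasDerivWithinAt)
    (by rw [hY.map_zero]; exact ContinuousLinearMap.norm_id_le)
    (fun t _ => by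
      rw [add_zero]
      refine (ContinuousLinearMap.opNorm_comp_le _ _).trans ?_
      gcongr
      exact norm_fderiv_le_of_lipschitz ℝ hF) t ht
  rw [gronwallBound_ε0, one_mul, sub_zero] at this
  refine this.trans ?_
  gcongr
  exact ht.2

/-- The error `e = Φ_t w - Φ_t z - Y_t (w - z)` solves `e' = F'(Φ_t z) e + ρ`, where the Taylor
remainder `ρ` is quadratic in `Φ_t w - Φ_t z`, hence in `w - z`. As `e(0) = 0`, Grönwall makes `e`
quadratically small, which identifies `Y_t` as the derivative of `Φ_t` at `z`. -/
theorem norm_flow_sub_sub_le_of_nonneg (hΦ : IsFlowOf F Φ) (hY : IsLinearizedFlow F Φ h z Y)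
    (hF : LipschitzWith K F) (hd : Differentiable ℝ F) (hF' : LipschitzWith K₂ (fderiv ℝ F))
    (hh : 0 < h) (w : Z) {t : ℝ} (ht : t ∈ Icc 0 h) :
    ‖Φ t w - Φ t z - Y t (w - z)‖ ≤
      gronwallBound 0 K (K₂ * Real.exp (K * h) ^ 2 * ‖w - z‖ ^ 2) h := by
  have := norm_le_gronwallBound_of_norm_deriv_right_le
    (f := fun t => Φ t w - Φ t z - Y t (w - z)) (δ := 0) (K := K)
    (ε := K₂ * Real.exp (K * h) ^ 2 * ‖w - z‖ ^ 2) (a := 0) (b := h)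
    (f' := fun t => F (Φ t w) - F (Φ t z) - fderiv ℝ F (Φ t z) (Y t (w - z)))
    (((hΦ.continuous_time w).sub (hΦ.continuous_time z)).continuousOn.sub
      ((hY.continuousOn.mono (Icc_subset_Icc_left (by linarith))).clm_apply continuousOn_const))
    (fun t ht => by
      have h1 := hY.hasDerivAt (t := t) ⟨by linarith [ht.1], ht.2⟩
      have h2 := h1.clm_apply (hasDerivAt_const t (w - z))
      have h3 := ((hΦ.hasDerivAt w t).sub (hΦ.hasDerivAt z t)).sub h2
      rw [ContinuousLinearMap.map_zero, add_zero] at h3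
      exact h3.hasDerivWithinAt)
    (by simp [hΦ.map_zero, hY.map_zero])
    (fun t ht => by
      have e : F (Φ t w) - F (Φ t z) - fderiv ℝ F (Φ t z) (Y t (w - z)) =
          fderiv ℝ F (Φ t z) (Φ t w - Φ t z - Y t (w - z)) +
          (F (Φ t w) - F (Φ t z) - fderiv ℝ F (Φ t z) (Φ t w - Φ t z)) := by
        simp only [map_sub]; abel
      rw [e]
      refine (norm_add_le _ _).trans (add_le_add ?_ ?_)
      · exact (ContinuousLinearMap.le_opNorm _ _).trans (by
          gcongr; exact norm_fderiv_le_of_lipschitz ℝ hF)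
      · refine (norm_sub_sub_fderiv_le hd hF' _ _).trans ?_
        rw [mul_assoc, ← mul_pow]
        gcongr
        refine (hΦ.norm_sub_le_of_nonneg hF w z ht.1).trans ?_
        rw [mul_comm]
        gcongr
        exact ht.2.le) t ht
  refine this.trans (gronwallBound_mono le_rfl (by positivity) K.2 ?_)
  linarith [ht.2]

/-- The same scheme for `Y' - Y`: the forcing term `(F'(Φ_t w) - F'(Φ_t z)) Y_t` is linear in `‖w -
z‖`. This gives the continuity of the derivative of the flow in the base point. -/
theorem norm_sub_le_of_nonneg (hΦ : IsFlowOf F Φ) (hY : IsLinearizedFlow F Φ h z Y)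
    (hY' : IsLinearizedFlow F Φ h w Y')
    (hF : LipschitzWith K F) (hF' : LipschitzWith K₂ (fderiv ℝ F))
    (hh : 0 < h) {t : ℝ} (ht : t ∈ Icc 0 h) :
    ‖Y' t - Y t‖ ≤ gronwallBound 0 K (K₂ * Real.exp (K * h) ^ 2 * ‖w - z‖) h := by
  have := norm_le_gronwallBound_of_norm_deriv_right_le
    (f := fun t => Y' t - Y t) (δ := 0) (K := K)
    (ε := K₂ * Real.exp (K * h) ^ 2 * ‖w - z‖) (a := 0) (b := h)
    (f' := fun t => (fderiv ℝ F (Φ t w)).comp (Y' t) - (fderiv ℝ F (Φ t z)).comp (Y t))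
    ((hY'.continuousOn.sub hY.continuousOn).mono (Icc_subset_Icc_left (by linarith)))
    (fun t ht => by
      have h1 := hY.hasDerivAt (t := t) ⟨by linarith [ht.1], ht.2⟩
      have h2 := hY'.hasDerivAt (t := t) ⟨by linarith [ht.1], ht.2⟩
      exact (h2.sub h1).hasDerivWithinAt)
    (by simp [hY'.map_zero, hY.map_zero])
    (fun t ht => by
      have e : (fderiv ℝ F (Φ t w)).comp (Y' t) - (fderiv ℝ F (Φ t z)).comp (Y t) =
          (fderiv ℝ F (Φ t w)).comp (Y' t - Y t) +
          (fderiv ℝ F (Φ t w) - fderiv ℝ F (Φ t z)).comp (Y t) := by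
        simp only [ContinuousLinearMap.comp_sub, ContinuousLinearMap.sub_comp]; abel
      rw [e]
      refine (norm_add_le _ _).trans (add_le_add ?_ ?_)
      · exact (ContinuousLinearMap.opNorm_comp_le _ _).trans (by
          gcongr; exact norm_fderiv_le_of_lipschitz ℝ hF)
      · refine (ContinuousLinearMap.opNorm_comp_le _ _).trans ?_
        have h1 := hF'.dist_le_mul (Φ t w) (Φ t z)
        rw [dist_eq_norm, dist_eq_norm] at h1
        have h2 : ‖Φ t w - Φ t z‖ ≤ ‖w - z‖ * Real.exp (K * h) :=
          (hΦ.norm_sub_le_of_nonneg hF w z ht.1).trans (by gcongr; exact ht.2.le)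
        have h3 := hY.norm_le_of_nonneg hF hh (Ico_subset_Icc_self ht)
        calc _ ≤ (K₂ * (‖w - z‖ * Real.exp (K * h))) * Real.exp (K * h) := by
              gcongr
              exact h1.trans (by gcongr)
          _ = _ := by ring) t ht
  refine this.trans (gronwallBound_mono le_rfl (by positivity) K.2 ?_)
  linarith [ht.2]

theorem norm_flow_sub_sub_le (hΦ : IsFlowOf F Φ) (hY : IsLinearizedFlow F Φ h z Y)
    (hF : LipschitzWith K F) (hd : Differentiable ℝ F) (hF' : LipschitzWith K₂ (fderiv ℝ F))
    (hh : 0 < h) (w : Z) {t : ℝ} (ht : t ∈ Icc (-h) h) :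
    ‖Φ t w - Φ t z - Y t (w - z)‖ ≤
      gronwallBound 0 K (K₂ * Real.exp (K * h) ^ 2 * ‖w - z‖ ^ 2) h := by
  rcases le_total 0 t with h0 | h0
  · exact hY.norm_flow_sub_sub_le_of_nonneg hΦ hF hd hF' hh w ⟨h0, ht.2⟩
  · have := hY.neg.norm_flow_sub_sub_le_of_nonneg (K := K) (K₂ := K₂) hΦ.neg
      hF.neg hd.neg (lipschitzWith_fderiv_neg hF') hh w
      (t := -t) ⟨by linarith, by linarith [ht.1]⟩
    simpa using this

theorem norm_sub_le (hΦ : IsFlowOf F Φ) (hY : IsLinearizedFlow F Φ h z Y)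
    (hY' : IsLinearizedFlow F Φ h w Y')
    (hF : LipschitzWith K F) (hF' : LipschitzWith K₂ (fderiv ℝ F))
    (hh : 0 < h) {t : ℝ} (ht : t ∈ Icc (-h) h) :
    ‖Y' t - Y t‖ ≤ gronwallBound 0 K (K₂ * Real.exp (K * h) ^ 2 * ‖w - z‖) h := by
  rcases le_total 0 t with h0 | h0
  · exact hY.norm_sub_le_of_nonneg hΦ hY' hF hF' hh ⟨h0, ht.2⟩
  · have := hY.neg.norm_sub_le_of_nonneg (K := K) (K₂ := K₂) hΦ.neg hY'.neg
      hF.neg (lipschitzWith_fderiv_neg hF') hh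
      (t := -t) ⟨by linarith, by linarith [ht.1]⟩
    simpa using this

end IsLinearizedFlow

/-- With zero initial error the bound is linear in the forcing, so it yields a constant times `‖w -
z‖²` or `‖w - z‖`. -/
theorem gronwallBound_zero_mul (K ε c x : ℝ) :
    gronwallBound 0 K (ε * c) x = gronwallBound 0 K ε x * c := by
  unfold gronwallBound
  split_ifs <;> ring

/-- On the unit ball around the identity the linear field has norm at most `2K`, so Picard–Lindelöf
stays in that ball for times up to `h` when `2Kh ≤ 1`. Short times suffice, because the group law
propagates the regularity. -/
theorem IsFlowOf.exists_isLinearizedFlow [CompleteSpace Z] {F : Z → Z} {Φ : ℝ → Z → Z} {K : ℝ≥0}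
    (hΦ : IsFlowOf F Φ) (hF : LipschitzWith K F) (hF' : Continuous (fderiv ℝ F)) {h : ℝ}
    (hh : 0 < h) (hKh : 2 * K * h ≤ 1) (z : Z) : ∃ Y, IsLinearizedFlow F Φ h z Y := by
  have h0 : (0 : ℝ) ∈ Icc (-h) h := ⟨by linarith, hh.le⟩
  have hP : IsPicardLindelof (fun t (Y : Z →L[ℝ] Z) => (fderiv ℝ F (Φ t z)).comp Y)
      (⟨0, h0⟩ : Icc (-h) h) (ContinuousLinearMap.id ℝ Z) 1 0 (2 * K) K :=
    { lipschitzOnWith := fun t _ => by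
        refine (LipschitzWith.of_dist_le_mul fun Y Y' => ?_).lipschitzOnWith
        rw [dist_eq_norm, dist_eq_norm, ← ContinuousLinearMap.comp_sub]
        refine (ContinuousLinearMap.opNorm_comp_le _ _).trans ?_
        gcongr
        exact norm_fderiv_le_of_lipschitz ℝ hF
      continuousOn := fun Y _ =>
        ((hF'.comp (hΦ.continuous_time z)).clm_comp continuous_const).continuousOn
      norm_le := fun t _ Y hY => by
        have hY2 : ‖Y‖ ≤ 2 := by
          have h1 : ‖Y - ContinuousLinearMap.id ℝ Z‖ ≤ 1 := by simpa [dist_eq_norm] using hY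
          have h2 := norm_add_le (Y - ContinuousLinearMap.id ℝ Z) (ContinuousLinearMap.id ℝ Z)
          have h3 : ‖ContinuousLinearMap.id ℝ Z‖ ≤ 1 := ContinuousLinearMap.norm_id_le
          rw [sub_add_cancel] at h2
          linarith
        refine (ContinuousLinearMap.opNorm_comp_le _ _).trans ?_
        have := norm_fderiv_le_of_lipschitz ℝ hF (x₀ := Φ t z)
        push_cast
        rw [mul_comm (2 : ℝ)]
        gcongr
      mul_max_le := by simpa using hKh }
  obtain ⟨Y, h1, h2⟩ := hP.exists_eq_forall_mem_Icc_hasDerivWithinAt₀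
  exact ⟨Y, h1, h2⟩

end Flow

/-! ### Joint `C¹` regularity of the flow -/

namespace IsFlowOf

variable {Z : Type*} [NormedAddCommGroup Z] [NormedSpace ℝ Z] {F : Z → Z} {Φ : ℝ → Z → Z}
  {K K₂ : ℝ≥0} {h : ℝ} {Y : Z → ℝ → Z →L[ℝ] Z}

theorem hasFDerivAt_of_linearized (hΦ : IsFlowOf F Φ) (hY : ∀ z, IsLinearizedFlow F Φ h z (Y z))
    (hF : LipschitzWith K F) (hd : Differentiable ℝ F) (hF' : LipschitzWith K₂ (fderiv ℝ F))
    (hh : 0 < h) {t : ℝ} (ht : t ∈ Icc (-h) h) (z : Z) : HasFDerivAt (Φ t) (Y z t) z := by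
  rw [hasFDerivAt_iff_isLittleO]
  have hO : (fun w => Φ t w - Φ t z - Y z t (w - z)) =O[𝓝 z] fun w => ‖w - z‖ ^ 2 := by
    refine Asymptotics.IsBigO.of_bound (gronwallBound 0 K (K₂ * Real.exp (K * h) ^ 2) h)
      (Eventually.of_forall fun w => ?_)
    refine ((hY z).norm_flow_sub_sub_le hΦ hF hd hF' hh w ht).trans ?_
    rw [gronwallBound_zero_mul]
    simp
  refine hO.trans_isLittleO ?_
  have := Asymptotics.isLittleO_norm_pow_id (E' := Z) one_lt_two
  exact (this.comp_tendsto (tendsto_sub_nhds_zero_iff.2 tendsto_id))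

theorem continuous_uncurry (hΦ : IsFlowOf F Φ) (hF : LipschitzWith K F) :
    Continuous fun p : ℝ × Z => Φ p.1 p.2 := by
  rw [continuous_iff_continuousAt]
  rintro ⟨σ, z⟩
  have := continuousOn_prod_of_continuousOn_lipschitzOnWith' (fun p : ℝ × Z => Φ p.1 p.2)
    (s := Icc (σ - 1) (σ + 1)) (t := univ) (Real.exp (K * (|σ| + 1))).toNNReal
    (fun s hs => (LipschitzWith.of_dist_le_mul fun x y => by
      rw [dist_eq_norm, dist_eq_norm, Real.coe_toNNReal _ (Real.exp_pos _).le, mul_comm]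
      refine (hΦ.norm_sub_le hF x y s).trans ?_
      gcongr
      rw [abs_le]
      constructor <;> linarith [hs.1, hs.2, neg_abs_le σ, le_abs_self σ]).lipschitzOnWith)
    (fun z _ => (hΦ.continuous_time z).continuousOn)
  exact this.continuousAt (prod_mem_nhds (Icc_mem_nhds (by linarith) (by linarith)) univ_mem)

theorem continuousOn_linearized (hΦ : IsFlowOf F Φ) (hY : ∀ z, IsLinearizedFlow F Φ h z (Y z))
    (hF : LipschitzWith K F) (hF' : LipschitzWith K₂ (fderiv ℝ F)) (hh : 0 < h) :
    ContinuousOn (fun p : ℝ × Z => Y p.2 p.1) (Icc (-h) h ×ˢ univ) := by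
  refine continuousOn_prod_of_continuousOn_lipschitzOnWith' (fun p : ℝ × Z => Y p.2 p.1)
    (gronwallBound 0 K (K₂ * Real.exp (K * h) ^ 2) h).toNNReal (fun t ht => ?_)
    (fun z _ => (hY z).continuousOn)
  refine (LipschitzWith.of_dist_le_mul fun x y => ?_).lipschitzOnWith
  rw [dist_eq_norm, dist_eq_norm, norm_sub_rev, norm_sub_rev x]
  refine ((hY x).norm_sub_le hΦ (hY y) hF hF' hh ht).trans ?_
  rw [gronwallBound_zero_mul]
  gcongr
  exact Real.le_coe_toNNReal _

/-- Both partial derivatives, `F ∘ Φ` in time and `Y` in space, are jointly continuous, hence `Φ` is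
jointly differentiable with a continuous derivative. -/
theorem contDiffAt_of_mem_Ioo (hΦ : IsFlowOf F Φ) (hY : ∀ z, IsLinearizedFlow F Φ h z (Y z))
    (hF : LipschitzWith K F) (hd : Differentiable ℝ F) (hF' : LipschitzWith K₂ (fderiv ℝ F))
    (hh : 0 < h) {t : ℝ} (ht : t ∈ Ioo (-h) h) (z : Z) :
    ContDiffAt ℝ 1 (fun p : ℝ × Z => Φ p.1 p.2) (t, z) := by
  have hc1 : Continuous fun p : ℝ × Z =>
      ContinuousLinearMap.toSpanSingleton ℝ (F (Φ p.1 p.2)) :=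
    (ContinuousLinearMap.toSpanSingletonCLE (𝕜 := ℝ) (E := Z)).continuous.comp
      (hF.continuous.comp (hΦ.continuous_uncurry hF))
  have hc2 : ContinuousOn (fun p : ℝ × Z => Y p.2 p.1) (Ioo (-h) h ×ˢ univ) :=
    (hΦ.continuousOn_linearized hY hF hF' hh).mono (prod_mono Ioo_subset_Icc_self Subset.rfl)
  have ho : IsOpen (Ioo (-h) h ×ˢ (univ : Set Z)) := isOpen_Ioo.prod isOpen_univ
  rw [contDiffAt_one_iff]
  refine ⟨fun p => (ContinuousLinearMap.toSpanSingleton ℝ (F (Φ p.1 p.2))).coprod (Y p.2 p.1),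
    Ioo (-h) h ×ˢ univ, ho.mem_nhds ⟨ht, trivial⟩, ?_, ?_⟩
  · have e : (fun p : ℝ × Z =>
        (ContinuousLinearMap.toSpanSingleton ℝ (F (Φ p.1 p.2))).coprod (Y p.2 p.1)) =
        fun p => (ContinuousLinearMap.toSpanSingleton ℝ (F (Φ p.1 p.2))).comp
          (ContinuousLinearMap.fst ℝ ℝ Z) + (Y p.2 p.1).comp (ContinuousLinearMap.snd ℝ ℝ Z) := by
      funext p; ext <;> simp
    rw [e]
    exact ((hc1.clm_comp continuous_const).continuousOn).add
      (hc2.clm_comp continuousOn_const)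
  · intro p hp
    refine (hasStrictFDerivAt_uncurry_coprod (f := Φ)
      (f₁ := fun s z => ContinuousLinearMap.toSpanSingleton ℝ (F (Φ s z)))
      (f₂ := fun s z => Y z s) (u := p) ?_ ?_ hc1.continuousAt
      (hc2.continuousAt (ho.mem_nhds hp))).hasFDerivAt
    · exact Eventually.of_forall fun v => (hΦ.hasDerivAt v.2 v.1).hasFDerivAt
    · filter_upwards [ho.mem_nhds hp] with v hv
      exact hΦ.hasFDerivAt_of_linearized hY hF hd hF' hh (Ioo_subset_Icc_self hv.1) v.2

theorem iterate_eq (hΦ : IsFlowOf F Φ) (hF : LipschitzWith K F) (σ : ℝ) (n : ℕ) :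
    (Φ σ)^[n] = Φ (n * σ) := by
  induction n with
  | zero => funext z; simp [hΦ.map_zero]
  | succ n ih =>
    funext z
    rw [Function.iterate_succ', ih, Function.comp_apply, ← hΦ.map_add hF]
    congr 1
    push_cast
    ring

variable [CompleteSpace Z]

/-- The group law removes the restriction to short times: `Φ_t` is the `n`-th iterate of `Φ_{t/n}`,
and near time `σ` one has `Φ_s = Φ_{s-σ} ∘ Φ_σ`. -/
theorem contDiff_uncurry (hΦ : IsFlowOf F Φ) (hF : LipschitzWith K F) (hd : Differentiable ℝ F)
    (hF' : LipschitzWith K₂ (fderiv ℝ F)) : ContDiff ℝ 1 fun p : ℝ × Z => Φ p.1 p.2 := by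
  obtain ⟨h, hh, hKh⟩ : ∃ h : ℝ, 0 < h ∧ 2 * K * h ≤ 1 :=
    ⟨1 / (2 * K + 1), by positivity, by
      rw [mul_one_div, div_le_one (by positivity)]; linarith⟩
  choose Y hY using hΦ.exists_isLinearizedFlow hF hF'.continuous hh hKh
  have hloc : ∀ t ∈ Ioo (-h) h, ContDiff ℝ 1 (Φ t) := fun t ht => contDiff_iff_contDiffAt.2 fun z =>
    (hΦ.contDiffAt_of_mem_Ioo hY hF hd hF' hh ht z).comp z (contDiffAt_const.prodMk contDiffAt_id)
  have hglob : ∀ t, ContDiff ℝ 1 (Φ t) := fun t => by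
    obtain ⟨n, hn⟩ := exists_nat_gt (|t| / h)
    have hn0 : (0 : ℝ) < n := lt_of_le_of_lt (by positivity) hn
    have ht : t = n * (t / n) := by field_simp
    have hsmall : |t / n| < h := by
      rw [abs_div, Nat.abs_cast, div_lt_iff₀ hn0]
      rw [div_lt_iff₀ hh] at hn
      linarith
    rw [ht, ← hΦ.iterate_eq hF]
    have hit : ∀ m : ℕ, ContDiff ℝ 1 (Φ (t / n))^[m] := by
      intro m
      induction m with
      | zero => exact contDiff_id
      | succ m ih => exact ih.comp (hloc _ (abs_lt.1 hsmall))
    exact hit n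
  rw [contDiff_iff_contDiffAt]
  rintro ⟨σ, z⟩
  have e : (fun p : ℝ × Z => Φ p.1 p.2) =
      (fun p : ℝ × Z => Φ p.1 p.2) ∘ fun p => (p.1 - σ, Φ σ p.2) := by
    funext p
    simp [← hΦ.map_add hF]
  rw [e]
  refine ContDiffAt.comp (σ, z) ?_ ?_
  · exact hΦ.contDiffAt_of_mem_Ioo hY hF hd hF' hh ⟨by simpa using hh, by simpa using hh⟩ _
  · exact ((contDiff_fst.sub contDiff_const).prodMk
      ((hglob σ).comp contDiff_snd)).contDiffAt

/-- The variational equation at all times. Near `σ` the derivative of `Φ_s` at `z` is the linearized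
flow from `Φ_σ z`, at time `s - σ`, composed with that of `Φ_σ`; differentiate at `s = σ`. -/
theorem hasDerivAt_fderiv (hΦ : IsFlowOf F Φ) (hF : LipschitzWith K F) (hd : Differentiable ℝ F)
    (hF' : LipschitzWith K₂ (fderiv ℝ F)) (z v : Z) (σ : ℝ) :
    HasDerivAt (fun σ => fderiv ℝ (Φ σ) z v) (fderiv ℝ F (Φ σ z) (fderiv ℝ (Φ σ) z v)) σ := by
  obtain ⟨h, hh, hKh⟩ : ∃ h : ℝ, 0 < h ∧ 2 * K * h ≤ 1 :=
    ⟨1 / (2 * K + 1), by positivity, by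
      rw [mul_one_div, div_le_one (by positivity)]; linarith⟩
  choose Y hY using hΦ.exists_isLinearizedFlow hF hF'.continuous hh hKh
  have hdiff : ∀ t, Differentiable ℝ (Φ t) := fun t =>
    ((hΦ.contDiff_uncurry hF hd hF').comp (contDiff_const.prodMk contDiff_id)).differentiable
      one_ne_zero
  have hev : (fun s => fderiv ℝ (Φ s) z v) =ᶠ[𝓝 σ]
      fun s => Y (Φ σ z) (s - σ) (fderiv ℝ (Φ σ) z v) := by
    filter_upwards [Icc_mem_nhds (show σ - h < σ by linarith) (show σ < σ + h by linarith)]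
      with s hs
    have e : Φ s = Φ (s - σ) ∘ Φ σ := by
      funext w
      simp [← hΦ.map_add hF]
    rw [e, ((hΦ.hasFDerivAt_of_linearized hY hF hd hF' hh (t := s - σ)
      ⟨by linarith [hs.1], by linarith [hs.2]⟩ (Φ σ z)).comp z (hdiff σ z).hasFDerivAt).fderiv]
    rfl
  refine HasDerivAt.congr_of_eventuallyEq ?_ hev
  have h0 : (0 : ℝ) ∈ Ioo (-h) h := ⟨by linarith, hh⟩
  have h1 : HasDerivAt (Y (Φ σ z)) (fderiv ℝ F (Φ σ z)) (σ - σ) := by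
    have := (hY (Φ σ z)).hasDerivAt h0
    rw [(hY (Φ σ z)).map_zero, hΦ.map_zero, ContinuousLinearMap.comp_id] at this
    rwa [sub_self]
  have h2 := (h1.comp_sub_const σ σ).clm_apply (hasDerivAt_const σ (fderiv ℝ (Φ σ) z v))
  simpa using h2

end IsFlowOf

/-! ### Backward transport equation and the Lyapunov gradient bound -/

section Transport

variable {d : ℕ}

local notation "E" => EuclideanSpace ℝ (Fin d)

theorem inner_le_maxJacobianForm (h : E → ℝ → E) (x : E) (t : ℝ) (w : E) :
    inner ℝ (fderiv ℝ (fun y => h y t) x w) w ≤ maxJacobianForm h x t * ‖w‖ ^ 2 := by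
  rcases eq_or_ne w 0 with rfl | hw
  · simp
  have hn : ‖w‖ ≠ 0 := norm_ne_zero_iff.2 hw
  set A := fderiv ℝ (fun y => h y t) x
  -- Boundedness is needed for the real supremum to dominate its terms.
  have hbdd : BddAbove (range fun ξ : Metric.sphere (0 : E) 1 => inner ℝ (A (ξ : E)) (ξ : E)) := by
    refine ⟨‖A‖, ?_⟩
    rintro _ ⟨ξ, rfl⟩
    have hξ : ‖(ξ : E)‖ = 1 := by simp
    refine (real_inner_le_norm _ _).trans ?_
    have := A.le_opNorm ξ
    rw [hξ] at this ⊢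
    simpa using this
  have hmem : ‖w‖⁻¹ • w ∈ Metric.sphere (0 : E) 1 := by
    rw [mem_sphere_zero_iff_norm, norm_smul, norm_inv, norm_norm, inv_mul_cancel₀ hn]
  have h1 : inner ℝ (A (‖w‖⁻¹ • w)) (‖w‖⁻¹ • w) ≤ maxJacobianForm h x t :=
    le_ciSup hbdd ⟨_, hmem⟩
  rw [map_smul, real_inner_smul_left, real_inner_smul_right] at h1
  calc inner ℝ (A w) w = (‖w‖⁻¹ * (‖w‖⁻¹ * inner ℝ (A w) w)) * ‖w‖ ^ 2 := by field_simp
    _ ≤ _ := by gcongr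

theorem maxJacobianForm_congr {h g : E → ℝ → E} {x : E} {t : ℝ}
    (e : (fun y => h y t) =ᶠ[𝓝 x] fun y => g y t) :
    maxJacobianForm h x t = maxJacobianForm g x t := by
  unfold maxJacobianForm
  rw [e.fderiv_eq]

/-- If `x' = β`, `w' = A w` and `⟨β, ∇V⟩ + 2⟨A w, w⟩ / |w|² ≤ C V` along `x`, then
`|w|² V(x)` grows at most like `exp (C σ)`. -/
theorem norm_sq_mul_le_exp {x w x' w' : ℝ → E} {V : E → ℝ} {C a : ℝ} (hV : Differentiable ℝ V)
    (hx : ∀ σ, HasDerivAt x (x' σ) σ) (hw : ∀ σ, HasDerivAt w (w' σ) σ)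
    (hle : ∀ σ ∈ Icc 0 a, 2 * inner ℝ (w' σ) (w σ) * V (x σ) +
      ‖w σ‖ ^ 2 * inner ℝ (x' σ) (gradient V (x σ)) ≤ C * (‖w σ‖ ^ 2 * V (x σ))) (ha : 0 ≤ a) :
    ‖w a‖ ^ 2 * V (x a) ≤ ‖w 0‖ ^ 2 * V (x 0) * Real.exp (C * a) := by
  have hder : ∀ σ, HasDerivAt (fun σ => ‖w σ‖ ^ 2 * V (x σ))
      (2 * inner ℝ (w' σ) (w σ) * V (x σ) +
        ‖w σ‖ ^ 2 * inner ℝ (x' σ) (gradient V (x σ))) σ := by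
    intro σ
    have h1 := (hw σ).norm_sq
    have h2 := (hV (x σ)).hasGradientAt.hasFDerivAt.comp_hasDerivAt σ (hx σ)
    have h3 : HasDerivAt (fun σ => ‖w σ‖ ^ 2 * V (x σ)) _ σ := h1.mul h2
    refine h3.congr_deriv ?_
    simp [real_inner_comm]
  have := le_gronwallBound_of_liminf_deriv_right_le
    (f := fun σ => ‖w σ‖ ^ 2 * V (x σ)) (δ := ‖w 0‖ ^ 2 * V (x 0)) (K := C) (ε := 0) (a := 0)
    (b := a) (fun σ _ => (hder σ).continuousAt.continuousWithinAt)
    (fun σ _ r hr => (hder σ).hasDerivWithinAt.liminf_right_slope_le hr) le_rfl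
    (fun σ hσ => by simpa using hle σ (Ico_subset_Icc_self hσ)) a ⟨ha, le_rfl⟩
  simpa [gronwallBound_ε0] using this

/-- If `|x'| ≤ C + C|x|` on `[0, a]`, then `x` is bounded in terms of its end point. -/
theorem norm_le_gronwallBound_of_norm_right_le {x x' : ℝ → E} {C R a : ℝ}
    (hx : ∀ σ, HasDerivAt x (x' σ) σ) (hle : ∀ σ ∈ Icc 0 a, ‖x' σ‖ ≤ C + C * ‖x σ‖)
    (hR : ‖x a‖ ≤ R) {σ : ℝ} (hσ : σ ∈ Icc 0 a) : ‖x σ‖ ≤ gronwallBound R C C (a - σ) := by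
  -- The known bound is at the end point, so Grönwall is run in reversed time.
  have hder : ∀ τ, HasDerivAt (fun τ => x (a - τ)) (-x' (a - τ)) τ := fun τ => by
    have h : HasDerivAt (fun τ => x (a - τ)) _ τ :=
      (hx (a - τ)).scomp τ ((hasDerivAt_id τ).const_sub a)
    simpa only [neg_smul, one_smul] using h
  have := norm_le_gronwallBound_of_norm_deriv_right_le (f := fun τ => x (a - τ)) (δ := R) (K := C)
    (ε := C) (a := 0) (b := a) (fun τ _ => (hder τ).continuousAt.continuousWithinAt)
    (fun τ _ => (hder τ).hasDerivWithinAt) (by simpa using hR)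
    (fun τ hτ => by
      rw [norm_neg, add_comm]
      exact hle _ ⟨by linarith [hτ.2], by linarith [hτ.1]⟩) (a - σ)
      ⟨by linarith [hσ.2], by linarith [hσ.1]⟩
  simpa using this

theorem hasGradientAt_of_contDiff {u : E → ℝ → ℝ}
    (hu : ContDiff ℝ 1 fun p : E × ℝ => u p.1 p.2) (x : E) (t : ℝ) :
    HasGradientAt (fun y => u y t) (gradient (fun y => u y t) x) x :=
  ((hu.comp (contDiff_id.prodMk contDiff_const)).differentiable one_ne_zero x).hasGradientAt

theorem continuous_gradient_of_contDiff {u : E → ℝ → ℝ}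
    (hu : ContDiff ℝ 1 fun p : E × ℝ => u p.1 p.2) :
    Continuous fun p : E × ℝ => gradient (fun y => u y p.2) p.1 := by
  have e : ∀ p : E × ℝ, fderiv ℝ (fun y => u y p.2) p.1 =
      (fderiv ℝ (fun p : E × ℝ => u p.1 p.2) p).comp (ContinuousLinearMap.inl ℝ E ℝ) := by
    intro p
    have h1 : HasFDerivAt (fun y : E => (y, p.2)) (ContinuousLinearMap.inl ℝ E ℝ) p.1 :=
      hasFDerivAt_prodMk_left p.1 p.2
    exact ((hu.differentiable one_ne_zero p).hasFDerivAt.comp p.1 h1).fderiv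
  unfold gradient
  refine (InnerProductSpace.toDual ℝ E).symm.continuous.comp ?_
  simp_rw [e]
  exact (hu.continuous_fderiv one_ne_zero).clm_comp continuous_const

theorem hasDerivAt_time_of_contDiff {u : E → ℝ → ℝ}
    (hu : ContDiff ℝ 1 fun p : E × ℝ => u p.1 p.2) (x : E) (t : ℝ) :
    HasDerivAt (u x) (deriv (u x) t) t :=
  ((hu.comp (contDiff_const.prodMk contDiff_id)).differentiable one_ne_zero t).hasDerivAt

theorem continuous_deriv_of_contDiff {u : E → ℝ → ℝ}
    (hu : ContDiff ℝ 1 fun p : E × ℝ => u p.1 p.2) :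
    Continuous fun p : E × ℝ => deriv (u p.1) p.2 := by
  have e : ∀ p : E × ℝ, deriv (u p.1) p.2 =
      fderiv ℝ (fun p : E × ℝ => u p.1 p.2) p (0, 1) := by
    intro p
    have h1 : HasDerivAt (fun s : ℝ => (p.1, s)) ((0 : E), (1 : ℝ)) p.2 :=
      (hasDerivAt_const p.2 p.1).prodMk (hasDerivAt_id p.2)
    exact ((hu.differentiable one_ne_zero p).hasFDerivAt.comp_hasDerivAt p.2 h1).deriv
  simp_rw [e]
  exact (hu.continuous_fderiv one_ne_zero).clm_apply continuous_const

theorem isTestFunction_of_contDiff {T : ℝ} {u : E → ℝ → ℝ}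
    (hu : ContDiff ℝ 1 fun p : E × ℝ => u p.1 p.2)
    (hR : ∃ R, ∀ x, ∀ t ∈ Ico 0 T, R < ‖x‖ → u x t = 0) :
    IsTestFunction T u (fun x t => deriv (u x) t) (fun x t => gradient (fun y => u y t) x) where
  hasDerivWithinAt x t _ := (hasDerivAt_time_of_contDiff hu x t).hasDerivWithinAt
  hasGradientAt x t _ := hasGradientAt_of_contDiff hu x t
  continuousOn := hu.continuous.continuousOn
  continuousOn_deriv := (continuous_deriv_of_contDiff hu).continuousOn
  continuousOn_gradient := (continuous_gradient_of_contDiff hu).continuousOn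
  eq_zero := hR

/-- The transport operator is the derivative in the space-time direction `(v, 1)`, so the transport
equation says that `u` is constant along the flow of `spaceTimeField`. -/
theorem fderiv_time_add_inner_gradient {u : E → ℝ → ℝ}
    (hu : ContDiff ℝ 1 fun p : E × ℝ => u p.1 p.2) (p : E × ℝ) (v : E) :
    fderiv ℝ (fun p : E × ℝ => u p.1 p.2) p (v, 1) =
      deriv (u p.1) p.2 + inner ℝ v (gradient (fun y => u y p.2) p.1) := by
  have h1 : HasDerivAt (fun s : ℝ => (p.1, s)) ((0 : E), (1 : ℝ)) p.2 :=
    (hasDerivAt_const p.2 p.1).prodMk (hasDerivAt_id p.2)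
  have hd : HasFDerivAt (fun p : E × ℝ => u p.1 p.2)
      (fderiv ℝ (fun p : E × ℝ => u p.1 p.2) p) (p.1, p.2) :=
    (hu.differentiable one_ne_zero p).hasFDerivAt
  have e1 : deriv (u p.1) p.2 = fderiv ℝ (fun p : E × ℝ => u p.1 p.2) p (0, 1) :=
    (hd.comp_hasDerivAt p.2 h1).deriv
  have h0 : HasFDerivAt (fun y : E => (y, p.2)) (ContinuousLinearMap.inl ℝ E ℝ) p.1 :=
    hasFDerivAt_prodMk_left p.1 p.2
  have e2 : inner ℝ v (gradient (fun y => u y p.2) p.1) =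
      fderiv ℝ (fun p : E × ℝ => u p.1 p.2) p (v, 0) := by
    have h5 := hd.comp p.1 h0
    have h2 := (hasGradientAt_of_contDiff hu p.1 p.2).hasFDerivAt.unique h5
    have h3 := congrArg (fun A : E →L[ℝ] ℝ => A v) h2
    simp only [InnerProductSpace.toDual_apply_apply] at h3
    rw [real_inner_comm, h3]
    simp
  rw [e1, e2, ← map_add]
  simp

/-- The space-time vector field `(β, 1)` on `ℝᵈ × ℝ`. -/
def spaceTimeField (β : E → ℝ → E) (p : E × ℝ) : E × ℝ := (β p.1 p.2, 1)

theorem spaceTimeField_regularity {β : E → ℝ → E} (hβ : ContDiff ℝ ∞ fun p : E × ℝ => β p.1 p.2)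
    (hc : HasCompactSupport fun p : E × ℝ => β p.1 p.2) :
    ∃ K L K₂ : ℝ≥0, LipschitzWith K (spaceTimeField β) ∧ (∀ p, ‖spaceTimeField β p‖ ≤ L) ∧
      Differentiable ℝ (spaceTimeField β) ∧ LipschitzWith K₂ (fderiv ℝ (spaceTimeField β)) ∧
      ∀ p, fderiv ℝ (spaceTimeField β) p = (ContinuousLinearMap.inl ℝ E ℝ).comp
        (fderiv ℝ (fun p : E × ℝ => β p.1 p.2) p) := by
  have e : spaceTimeField β = fun p => ContinuousLinearMap.inl ℝ E ℝ (β p.1 p.2) + (0, 1) := by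
    funext p; simp [spaceTimeField]
  have hd : Differentiable ℝ fun p : E × ℝ => β p.1 p.2 := hβ.differentiable (by simp)
  have hfd : ∀ p, fderiv ℝ (spaceTimeField β) p = (ContinuousLinearMap.inl ℝ E ℝ).comp
        (fderiv ℝ (fun p : E × ℝ => β p.1 p.2) p) := by
    intro p
    rw [e]
    exact (((ContinuousLinearMap.inl ℝ E ℝ).hasFDerivAt.comp p (hd p).hasFDerivAt).add_const
      _).fderiv
  obtain ⟨K, hK⟩ := ContDiff.lipschitzWith_of_hasCompactSupport hc hβ (by simp)
  have hβ' : ContDiff ℝ 1 (fderiv ℝ fun p : E × ℝ => β p.1 p.2) :=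
    hβ.fderiv_right (m := 1) (by norm_cast)
  obtain ⟨K₂, hK₂⟩ := ContDiff.lipschitzWith_of_hasCompactSupport (hc.fderiv ℝ) hβ' (by simp)
  obtain ⟨L, hL⟩ := hc.exists_bound_of_continuous hβ.continuous
  -- The time component `1` is constant: it adds `0` to the Lipschitz constant and `1` to the
  -- sup-norm bound.
  refine ⟨max K 0, (max L 1).toNNReal,
    ‖ContinuousLinearMap.compL ℝ (E × ℝ) E (E × ℝ) (ContinuousLinearMap.inl ℝ E ℝ)‖₊ * K₂,
    hK.prodMk (LipschitzWith.const 1), fun p => ?_, ?_, ?_, hfd⟩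
  · rw [Real.coe_toNNReal _ (by positivity)]
    exact norm_prod_le_iff.2 ⟨(hL p).trans (le_max_left _ _), by
      simp [spaceTimeField]⟩
  · rw [e]
    exact ((ContinuousLinearMap.inl ℝ E ℝ).differentiable.comp hd).add_const _
  · have : fderiv ℝ (spaceTimeField β) =
        ContinuousLinearMap.compL ℝ (E × ℝ) E (E × ℝ) (ContinuousLinearMap.inl ℝ E ℝ) ∘
          fderiv ℝ (fun p : E × ℝ => β p.1 p.2) := by
      funext p; rw [hfd]; rfl
    rw [this]
    exact (ContinuousLinearMap.lipschitz _).comp hK₂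

namespace IsFlowOf

theorem snd_eq {β : E → ℝ → E} {Φ : ℝ → E × ℝ → E × ℝ}
    (hΦ : IsFlowOf (spaceTimeField β) Φ) (σ : ℝ) (p : E × ℝ) :
    (Φ σ p).2 = p.2 + σ := by
  have h : ∀ σ, HasDerivAt (fun σ => (Φ σ p).2 - σ) 0 σ := fun σ => by
    have := ((hasFDerivAt_snd (p := Φ σ p)).comp_hasDerivAt σ (hΦ.hasDerivAt p σ)).sub
      (hasDerivAt_id σ)
    exact HasDerivAt.congr_deriv (f := fun σ => (Φ σ p).2 - σ) this (by simp [spaceTimeField])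
  have := is_const_of_deriv_eq_zero (fun σ => (h σ).differentiableAt) (fun σ => (h σ).deriv) σ 0
  rw [hΦ.map_zero, sub_zero] at this
  linarith

theorem hasDerivAt_fst {β : E → ℝ → E} {Φ : ℝ → E × ℝ → E × ℝ}
    (hΦ : IsFlowOf (spaceTimeField β) Φ) (σ : ℝ) (p : E × ℝ) :
    HasDerivAt (fun σ => (Φ σ p).1) (β (Φ σ p).1 (p.2 + σ)) σ := by
  have := (hasFDerivAt_fst (p := Φ σ p)).comp_hasDerivAt σ (hΦ.hasDerivAt p σ)
  rw [← hΦ.snd_eq]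
  exact this

theorem norm_fst_sub_le {β : E → ℝ → E} {Φ : ℝ → E × ℝ → E × ℝ}
    (hΦ : IsFlowOf (spaceTimeField β) Φ) {L : ℝ≥0} (hL : ∀ x t, ‖β x t‖ ≤ L)
    (σ : ℝ) (p : E × ℝ) : ‖(Φ σ p).1 - p.1‖ ≤ L * |σ| := by
  have := (convex_univ : Convex ℝ (univ : Set ℝ)).norm_image_sub_le_of_norm_hasDerivWithin_le
    (f := fun σ => (Φ σ p).1) (f' := fun σ => β (Φ σ p).1 (p.2 + σ)) (C := L)
    (fun σ _ => (hΦ.hasDerivAt_fst σ p).hasDerivWithinAt) (fun σ _ => hL _ _)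
    (mem_univ 0) (mem_univ σ)
  simpa [hΦ.map_zero] using this

end IsFlowOf

/-- Classical solutions of the backward transport equation `∂ₜu + ⟨β, ∇u⟩ = 0`, `u(·, t₀) = ψ`,
with a gradient bound in terms of a Lyapunov-type function `V`. -/
theorem exists_transport_solution {T C₁ C₂ c R r M : ℝ} (hC₂ : 0 ≤ C₂) (hC₁ : 0 ≤ C₁) (hR : 0 ≤ R)
    (hc : 0 < c) (hM : 0 ≤ M)
    {β : E → ℝ → E} (hβ : ContDiff ℝ ∞ fun p : E × ℝ => β p.1 p.2)
    (hβc : HasCompactSupport fun p : E × ℝ => β p.1 p.2)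
    (hgrowth : ∀ x, ∀ t ∈ Icc 0 T, ‖β x t‖ ≤ C₁ + C₁ * ‖x‖)
    (hr : gronwallBound R C₁ C₁ T < r)
    {V : E → ℝ} (hV : Differentiable ℝ V) (hVc : ∀ x ∈ Metric.ball (0 : E) r, c ≤ V x)
    (hVβ : ∀ x ∈ Metric.ball (0 : E) r, ∀ t ∈ Icc 0 T,
      inner ℝ (β x t) (gradient V x) ≤ (C₂ - 2 * maxJacobianForm β x t) * V x)
    {ψ : E → ℝ} (hψ : ContDiff ℝ 1 ψ) (hψR : ∀ x, R < ‖x‖ → ψ x = 0)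
    (hψM : ∀ x, ‖fderiv ℝ ψ x‖ ≤ M) :
    ∃ Λ : ℝ, 0 ≤ Λ ∧ ∀ t₀ ∈ Icc 0 T, ∃ u : E → ℝ → ℝ, ContDiff ℝ 1 (fun p : E × ℝ => u p.1 p.2) ∧
      (∃ R', ∀ x, ∀ t ∈ Icc 0 T, R' < ‖x‖ → u x t = 0) ∧
      (∀ x, ∀ s ∈ Icc 0 t₀, x ∉ Metric.ball (0 : E) r →
        u x s = 0 ∧ gradient (fun y => u y s) x = 0) ∧
      (∀ x s, deriv (u x) s + inner ℝ (β x s) (gradient (fun y => u y s) x) = 0) ∧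
      (∀ x ∈ Metric.ball (0 : E) r, ∀ s ∈ Icc 0 t₀, ‖gradient (fun y => u y s) x‖ ≤
        M * √(Real.exp (C₂ * T) / c) * √(V x)) ∧
      ∀ x s, |u x s - ψ x| ≤ Λ * |t₀ - s| := by
  obtain ⟨K, L, K₂, hF, hL, hd, hF', hfd⟩ := spaceTimeField_regularity hβ hβc
  obtain ⟨Φ, hΦ⟩ := exists_isFlowOf hF hL
  have hLβ : ∀ x t, ‖β x t‖ ≤ L := fun x t => (norm_fst_le (spaceTimeField β (x, t))).trans (hL _)
  have hΦC := hΦ.contDiff_uncurry hF hd hF'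
  have hψd : Differentiable ℝ ψ := hψ.differentiable one_ne_zero
  -- `ψ` is `M`-Lipschitz and trajectories have speed at most `L`. The constant may depend on the
  -- field, but not on `t₀`.
  refine ⟨M * L, by positivity, fun t₀ ht₀ => ?_⟩
  have huC : ContDiff ℝ 1 fun p : E × ℝ => ψ (Φ (t₀ - p.2) p).1 :=
    hψ.comp (contDiff_fst.comp (hΦC.comp
      ((contDiff_const.sub contDiff_snd).prodMk contDiff_id)))
  -- `u` is constant along trajectories, since all points of one trajectory reach the same point at
  -- time `t₀`.
  have hinv : ∀ (σ : ℝ) (p : E × ℝ), ψ (Φ (t₀ - (Φ σ p).2) (Φ σ p)).1 = ψ (Φ (t₀ - p.2) p).1 := by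
    intro σ p
    rw [← hΦ.map_add hF, hΦ.snd_eq]
    congr 3
    ring
  -- the trajectories that end in `closedBall 0 R` stay in `ball 0 r`
  have hstay : ∀ x, ∀ s ∈ Icc 0 t₀, ‖(Φ (t₀ - s) (x, s)).1‖ ≤ R → ∀ σ ∈ Icc 0 (t₀ - s),
      (Φ σ (x, s)).1 ∈ Metric.ball (0 : E) r := by
    intro x s hs hle σ hσ
    rw [mem_ball_zero_iff]
    have := norm_le_gronwallBound_of_norm_right_le (a := t₀ - s) (C := C₁) (R := R)
      (fun σ => hΦ.hasDerivAt_fst σ (x, s))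
      (fun σ hσ => hgrowth _ _ ⟨by linarith [hσ.1, hs.1], by
        have := hσ.2; have := ht₀.2; dsimp only; linarith⟩) hle hσ
    refine (this.trans (gronwallBound_mono hR hC₁ hC₁ ?_)).trans_lt hr
    linarith [hσ.1, hs.1, ht₀.2]
  have hgrad : ∀ (x : E) (s : ℝ) (v : E), inner ℝ (gradient (fun y => ψ (Φ (t₀ - s) (y, s)).1) x) v
      = fderiv ℝ ψ (Φ (t₀ - s) (x, s)).1 (fderiv ℝ (Φ (t₀ - s)) (x, s) (v, 0)).1 := by
    intro x s v
    have hΦd : DifferentiableAt ℝ (Φ (t₀ - s)) (x, s) :=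
      (hΦC.comp (contDiff_const.prodMk contDiff_id)).differentiable one_ne_zero _
    have h0 : HasFDerivAt (fun y : E => (y, s)) (ContinuousLinearMap.inl ℝ E ℝ) x :=
      hasFDerivAt_prodMk_left x s
    have h1 := hΦd.hasFDerivAt.comp x h0
    have h2 := (hasFDerivAt_fst (𝕜 := ℝ) (p := Φ (t₀ - s) (x, s))).comp x h1
    have h3 := (hψd (Φ (t₀ - s) (x, s)).1).hasFDerivAt.comp x h2
    have h4 := (hasGradientAt_of_contDiff (u := fun y s => ψ (Φ (t₀ - s) (y, s)).1) huC x
      s).hasFDerivAt.unique h3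
    have h5 := congrArg (fun A : E →L[ℝ] ℝ => A v) h4
    simp only [InnerProductSpace.toDual_apply_apply] at h5
    rw [h5]
    rfl
  have hfar : ∀ x s, R < ‖(Φ (t₀ - s) (x, s)).1‖ → ψ (Φ (t₀ - s) (x, s)).1 = 0 ∧
      gradient (fun y => ψ (Φ (t₀ - s) (y, s)).1) x = 0 := by
    intro x s h
    refine ⟨hψR _ h, ?_⟩
    have hz : ψ =ᶠ[𝓝 (Φ (t₀ - s) (x, s)).1] fun _ => 0 := by
      filter_upwards [(isOpen_lt continuous_const continuous_norm).mem_nhds h] with y hy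
      exact hψR y hy
    refine ext_inner_right ℝ fun v => ?_
    rw [hgrad, hz.fderiv_eq]
    simp
  refine ⟨fun x s => ψ (Φ (t₀ - s) (x, s)).1, huC, ⟨R + L * T, fun x t ht hx => ?_⟩,
    fun x s hs hx => ?_, fun x s => ?_, fun x hx s hs => ?_, fun x s => ?_⟩
  · refine hψR _ ?_
    have h1 := hΦ.norm_fst_sub_le hLβ (t₀ - t) (x, t)
    have h2 : |t₀ - t| ≤ T := by
      rw [abs_le]; constructor <;> linarith [ht.1, ht.2, ht₀.1, ht₀.2]
    have h3 : (L : ℝ) * |t₀ - t| ≤ L * T := by gcongr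
    have h4 := norm_sub_norm_le x (Φ (t₀ - t) (x, t)).1
    rw [norm_sub_rev] at h4
    dsimp only at h1
    linarith
  · refine hfar x s (lt_of_not_ge fun hle => hx ?_)
    simpa [hΦ.map_zero] using hstay x s hs hle 0 ⟨le_rfl, by linarith [hs.2]⟩
  · rw [← fderiv_time_add_inner_gradient (u := fun x s => ψ (Φ (t₀ - s) (x, s)).1) huC (x, s)]
    have hu' := (huC.differentiable one_ne_zero (Φ 0 (x, s))).hasFDerivAt.comp_hasDerivAt 0
      (hΦ.hasDerivAt (x, s) 0)
    have e : (fun p : E × ℝ => ψ (Φ (t₀ - p.2) p).1) ∘ (fun σ => Φ σ (x, s)) =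
        fun _ => ψ (Φ (t₀ - s) (x, s)).1 := by
      funext σ; exact hinv σ (x, s)
    rw [e, hΦ.map_zero] at hu'
    exact hu'.unique (hasDerivAt_const _ _)
  · by_cases hle : ‖(Φ (t₀ - s) (x, s)).1‖ ≤ R
    swap
    · rw [(hfar x s (not_le.1 hle)).2, norm_zero]
      positivity
    have hst := hstay x s hs hle
    have ha : 0 ≤ t₀ - s := by linarith [hs.2]
    -- Let `w` be the derivative of the flow in the direction `(v, 0)`. Compare `|w|² V` at the two
    -- ends of the trajectory, with `V ≥ c` at the final one.
    have hkey : ∀ v : E, ‖(fderiv ℝ (Φ (t₀ - s)) (x, s) (v, 0)).1‖ ^ 2 * c ≤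
        ‖v‖ ^ 2 * V x * Real.exp (C₂ * T) := by
      intro v
      have hw := fun σ => hΦ.hasDerivAt_fderiv hF hd hF' (x, s) (v, 0) σ
      -- The time component of the field is constant, so the variation remains purely spatial and
      -- only the Jacobian in `x` acts on it.
      have hw2 : ∀ σ, (fderiv ℝ (Φ σ) (x, s) (v, 0)).2 = 0 := by
        intro σ
        have h : ∀ σ, HasDerivAt (fun σ => (fderiv ℝ (Φ σ) (x, s) (v, 0)).2) 0 σ := fun σ => by
          have := (hasFDerivAt_snd (𝕜 := ℝ)
            (p := fderiv ℝ (Φ σ) (x, s) (v, 0))).comp_hasDerivAt σ (hw σ)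
          rw [hfd] at this
          exact HasDerivAt.congr_deriv (f := fun σ => (fderiv ℝ (Φ σ) (x, s) (v, 0)).2) this
            (by simp)
        have := is_const_of_deriv_eq_zero (fun σ => (h σ).differentiableAt)
          (fun σ => (h σ).deriv) σ 0
        rw [this]
        have e0 : Φ 0 = id := funext hΦ.map_zero
        rw [e0]; simp
      have hw1 : ∀ σ, HasDerivAt (fun σ => (fderiv ℝ (Φ σ) (x, s) (v, 0)).1)
          (fderiv ℝ (fun y => β y (s + σ)) (Φ σ (x, s)).1
            (fderiv ℝ (Φ σ) (x, s) (v, 0)).1) σ := by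
        intro σ
        have h1 := (hasFDerivAt_fst (𝕜 := ℝ)
          (p := fderiv ℝ (Φ σ) (x, s) (v, 0))).comp_hasDerivAt σ (hw σ)
        refine HasDerivAt.congr_deriv (f := fun σ => (fderiv ℝ (Φ σ) (x, s) (v, 0)).1) h1 ?_
        rw [hfd]
        have h0 : HasFDerivAt (fun y : E => (y, s + σ)) (ContinuousLinearMap.inl ℝ E ℝ)
          (Φ σ (x, s)).1 := hasFDerivAt_prodMk_left _ _
        have hβd : HasFDerivAt (fun p : E × ℝ => β p.1 p.2)
          (fderiv ℝ (fun p : E × ℝ => β p.1 p.2) (Φ σ (x, s))) ((Φ σ (x, s)).1, s + σ) := by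
          have e2 : ((Φ σ (x, s)).1, s + σ) = Φ σ (x, s) :=
            Prod.ext rfl (hΦ.snd_eq σ (x, s)).symm
          rw [e2]
          exact (hβ.differentiable (by simp) _).hasFDerivAt
        have h2 := (hβd.comp (Φ σ (x, s)).1 h0).fderiv
        have h3 : fderiv ℝ (fun y => β y (s + σ)) (Φ σ (x, s)).1 = _ := h2
        rw [h3]
        have e3 : ContinuousLinearMap.inl ℝ E ℝ (fderiv ℝ (Φ σ) (x, s) (v, 0)).1 =
            fderiv ℝ (Φ σ) (x, s) (v, 0) := Prod.ext rfl (hw2 σ).symm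
        rw [ContinuousLinearMap.comp_apply, ContinuousLinearMap.comp_apply, e3]
        rfl
      have := norm_sq_mul_le_exp (C := C₂) (a := t₀ - s) hV
        (fun σ => hΦ.hasDerivAt_fst σ (x, s)) hw1 (fun σ hσ => by
          have hmem := hst σ hσ
          have htime : s + σ ∈ Icc 0 T :=
            ⟨by linarith [hσ.1, hs.1], by linarith [hσ.2, ht₀.2]⟩
          have hVpos : 0 ≤ V (Φ σ (x, s)).1 := hc.le.trans (hVc _ hmem)
          -- The term `-2 max⟨𝓑ξ, ξ⟩ |w|² V` of the Lyapunov condition cancels the bound for `2⟨𝓑w,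
          -- w⟩ V`, leaving `C₂ |w|² V`.
          have h1 := hVβ _ hmem _ htime
          have h2 := inner_le_maxJacobianForm β (Φ σ (x, s)).1 (s + σ)
            (fderiv ℝ (Φ σ) (x, s) (v, 0)).1
          have h3 := mul_le_mul_of_nonneg_right h2 hVpos
          have h4 := mul_le_mul_of_nonneg_left h1
            (sq_nonneg ‖(fderiv ℝ (Φ σ) (x, s) (v, 0)).1‖)
          dsimp only at h3 h4 ⊢
          linarith) ha
      have e0 : Φ 0 = id := funext hΦ.map_zero
      rw [e0] at this
      simp only [fderiv_id, id_eq, ContinuousLinearMap.id_apply] at this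
      have hend := hVc _ (hst (t₀ - s) ⟨ha, le_rfl⟩)
      calc _ ≤ _ := mul_le_mul_of_nonneg_left hend (sq_nonneg _)
        _ ≤ _ := this
        _ ≤ _ := by
          have : 0 ≤ V x := hc.le.trans (hVc x hx)
          gcongr
          linarith [hs.1, ht₀.2]
    have hVx : 0 ≤ V x := hc.le.trans (hVc x hx)
    have hnorm : ∀ v : E, ‖(fderiv ℝ (Φ (t₀ - s)) (x, s) (v, 0)).1‖ ≤
        √(Real.exp (C₂ * T) / c) * √(V x) * ‖v‖ := by
      intro v
      refine le_of_sq_le_sq ?_ (by positivity)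
      rw [mul_pow, mul_pow, Real.sq_sqrt (by positivity), Real.sq_sqrt hVx]
      have := hkey v
      rw [← le_div_iff₀ hc] at this
      refine this.trans (le_of_eq ?_)
      ring
    -- Taking the direction `v` equal to the gradient `g` itself bounds `|g|²` by a multiple of
    -- `|g|`.
    have hg := hgrad x s (gradient (fun y => ψ (Φ (t₀ - s) (y, s)).1) x)
    rw [real_inner_self_eq_norm_sq] at hg
    set g := gradient (fun y => ψ (Φ (t₀ - s) (y, s)).1) x
    have h1 : ‖g‖ ^ 2 ≤ M * (√(Real.exp (C₂ * T) / c) * √(V x) * ‖g‖) := by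
      rw [hg]
      refine (le_abs_self _).trans ?_
      refine ((fderiv ℝ ψ _).le_opNorm _).trans ?_
      gcongr
      · exact hψM _
      · exact hnorm g
    rcases eq_or_ne g 0 with h | h
    · rw [h, norm_zero]; positivity
    · have hpos := norm_pos_iff.2 h
      refine le_of_mul_le_mul_right ?_ hpos
      calc ‖g‖ * ‖g‖ = ‖g‖ ^ 2 := by ring
        _ ≤ _ := h1
        _ = _ := by ring
  · have h1 := (convex_univ : Convex ℝ (univ : Set E)).norm_image_sub_le_of_norm_fderiv_le (𝕜 := ℝ)
      (f := ψ) (C := M) (fun x _ => hψd x) (fun x _ => hψM x) (mem_univ x)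
      (mem_univ (Φ (t₀ - s) (x, s)).1)
    have h2 := hΦ.norm_fst_sub_le hLβ (t₀ - s) (x, s)
    rw [Real.norm_eq_abs] at h1
    rw [mul_assoc]
    exact h1.trans (by gcongr)

theorem exists_cutoff (r T : ℝ) : ∃ χ : E × ℝ → ℝ, ContDiff ℝ ∞ χ ∧ HasCompactSupport χ ∧
    (∀ p, χ p ∈ Icc (0 : ℝ) 1) ∧ ∀ x ∈ Metric.ball (0 : E) r, ∀ t ∈ Icc 0 T, χ (x, t) = 1 := by
  have hpos : 0 < max 1 (max r T) := lt_max_of_lt_left one_pos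
  let f : ContDiffBump (0 : E × ℝ) := ⟨max 1 (max r T), max 1 (max r T) + 1, hpos, lt_add_one _⟩
  refine ⟨f, f.contDiff, f.hasCompactSupport, fun p => ⟨f.nonneg, f.le_one⟩,
    fun x hx t ht => f.one_of_mem_closedBall ?_⟩
  rw [mem_closedBall_zero_iff, norm_prod_le_iff]
  rw [mem_ball_zero_iff] at hx
  refine ⟨hx.le.trans ((le_max_left r T).trans (le_max_right _ _)), ?_⟩
  rw [Real.norm_of_nonneg ht.1]
  exact ht.2.trans ((le_max_right r T).trans (le_max_right _ _))

/-- Version of `exists_transport_solution` for fields without compact support: the transport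
equation holds in a ball outside of which the solution vanishes. -/
theorem exists_local_transport_solution {T C₁ C₂ c R r M : ℝ} (hC₂ : 0 ≤ C₂) (hC₁ : 0 ≤ C₁)
    (hR : 0 ≤ R) (hc : 0 < c) (hM : 0 ≤ M)
    {b : E → ℝ → E} (hb : ContDiff ℝ ∞ fun p : E × ℝ => b p.1 p.2)
    (hgrowth : ∀ x, ∀ t ∈ Icc 0 T, ‖b x t‖ ≤ C₁ + C₁ * ‖x‖)
    (hr : gronwallBound R C₁ C₁ T < r)
    {V : E → ℝ} (hV : Differentiable ℝ V) (hVc : ∀ x ∈ Metric.ball (0 : E) r, c ≤ V x)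
    (hVb : ∀ x ∈ Metric.ball (0 : E) r, ∀ t ∈ Icc 0 T,
      inner ℝ (b x t) (gradient V x) ≤ (C₂ - 2 * maxJacobianForm b x t) * V x)
    {ψ : E → ℝ} (hψ : ContDiff ℝ 1 ψ) (hψR : ∀ x, R < ‖x‖ → ψ x = 0)
    (hψM : ∀ x, ‖fderiv ℝ ψ x‖ ≤ M) :
    ∃ Λ : ℝ, 0 ≤ Λ ∧ ∀ t₀ ∈ Icc 0 T, ∃ u : E → ℝ → ℝ, ContDiff ℝ 1 (fun p : E × ℝ => u p.1 p.2) ∧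
      (∃ R', ∀ x, ∀ t ∈ Icc 0 T, R' < ‖x‖ → u x t = 0) ∧
      (∀ x, ∀ s ∈ Icc 0 t₀, x ∉ Metric.ball (0 : E) r →
        u x s = 0 ∧ gradient (fun y => u y s) x = 0 ∧ deriv (u x) s = 0) ∧
      (∀ x ∈ Metric.ball (0 : E) r, ∀ s ∈ Icc 0 t₀,
        deriv (u x) s = -inner ℝ (b x s) (gradient (fun y => u y s) x)) ∧
      (∀ x ∈ Metric.ball (0 : E) r, ∀ s ∈ Icc 0 t₀, ‖gradient (fun y => u y s) x‖ ≤
        M * √(Real.exp (C₂ * T) / c) * √(V x)) ∧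
      ∀ x s, |u x s - ψ x| ≤ Λ * |t₀ - s| := by
  obtain ⟨χ, hχ, hχc, hχ01, hχ1⟩ := exists_cutoff (d := d) r T
  have heq : ∀ x ∈ Metric.ball (0 : E) r, ∀ t ∈ Icc 0 T, χ (x, t) • b x t = b x t :=
    fun x hx t ht => by rw [hχ1 x hx t ht, one_smul]
  obtain ⟨Λ, hΛ, h⟩ := exists_transport_solution (T := T) (β := fun x t => χ (x, t) • b x t)
    hC₂ hC₁ hR hc hM (hχ.smul hb) hχc.smul_right (fun x t ht => by
      rw [norm_smul, Real.norm_of_nonneg (hχ01 _).1]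
      calc _ ≤ 1 * ‖b x t‖ := by gcongr; exact (hχ01 _).2
        _ ≤ _ := by rw [one_mul]; exact hgrowth x t ht) hr hV hVc (fun x hx t ht => by
      -- The ball is open and `χ = 1` on it at time `t`, so the cutoff does not change the spatial
      -- Jacobian at `x`.
      have e : maxJacobianForm (fun x t => χ (x, t) • b x t) x t = maxJacobianForm b x t := by
        refine maxJacobianForm_congr ?_
        filter_upwards [Metric.isOpen_ball.mem_nhds hx] with y hy
        exact heq y hy t ht
      rw [heq x hx t ht, e]
      exact hVb x hx t ht) hψ hψR hψM
  refine ⟨Λ, hΛ, fun t₀ ht₀ => ?_⟩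
  obtain ⟨u, h1, h2, h3, h4, h5, h6⟩ := h t₀ ht₀
  refine ⟨u, h1, h2, fun x s hs hx => ⟨(h3 x s hs hx).1, (h3 x s hs hx).2, ?_⟩,
    fun x hx s hs => ?_, h5, h6⟩
  · have := h4 x s
    rwa [(h3 x s hs hx).2, inner_zero_right, add_zero] at this
  · have := h4 x s
    rw [heq x hx s ⟨hs.1, hs.2.trans ht₀.2⟩] at this
    linarith

end Transport

/-! ### Hahn decomposition and integration for locally bounded signed measures -/

namespace LocMeasure

variable {X : Type*} [MetricSpace X] [ProperSpace X] [MeasurableSpace X] [BorelSpace X]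

theorem iUnion_piece (X : Type*) [MetricSpace X] [ProperSpace X] : ⋃ n, piece X n = univ := by
  unfold piece
  rw [iUnion_disjointed, CompactExhaustion.iUnion_eq]

theorem disjoint_piece (X : Type*) [MetricSpace X] [ProperSpace X] :
    Pairwise (Function.onFun Disjoint (piece X)) :=
  disjoint_disjointed _

theorem apply_inter_add_diff {X : Type*} [MetricSpace X] [ProperSpace X] [MeasurableSpace X]
    (μ : LocMeasure X) {A H : Set X} (hA : MeasurableSet A)
    (hb : Bornology.IsBounded A) (hH : MeasurableSet H) : μ (A ∩ H) + μ (A \ H) = μ A := by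
  have hs := (μ.restrict A hA ⟨closure A, hb.isCompact_closure, subset_closure⟩).of_add_of_sdiff
    hH MeasurableSet.univ (subset_univ H)
  have e : ∀ S, MeasurableSet S →
      μ.restrict A hA ⟨closure A, hb.isCompact_closure, subset_closure⟩ S = μ (S ∩ A) :=
    fun S hS => if_pos hS
  rw [e _ hH, e _ (MeasurableSet.univ.diff hH), e _ MeasurableSet.univ, univ_inter, inter_comm,
    ← compl_eq_univ_sdiff] at hs
  rw [sdiff_eq, inter_comm A Hᶜ]
  exact hs

/-- The parts of `μ` are given by a Hahn decomposition of the space. -/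
theorem exists_hahn (μ : LocMeasure X) : ∃ H, MeasurableSet H ∧
    ∀ A, MeasurableSet A → Bornology.IsBounded A →
      0 ≤ μ (A ∩ H) ∧ μ.posPart A = ENNReal.ofReal (μ (A ∩ H)) ∧
      μ (A \ H) ≤ 0 ∧ μ.negPart A = ENNReal.ofReal (-μ (A \ H)) := by
  have hpiece : ∀ n, ∃ i, MeasurableSet i ∧ ∀ A, MeasurableSet A →
      0 ≤ μ (i ∩ A ∩ piece X n) ∧
      (μ.jordanPiece n).posPart A = ENNReal.ofReal (μ (i ∩ A ∩ piece X n)) ∧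
      μ (iᶜ ∩ A ∩ piece X n) ≤ 0 ∧
      (μ.jordanPiece n).negPart A = ENNReal.ofReal (-μ (iᶜ ∩ A ∩ piece X n)) := by
    intro n
    obtain ⟨i, hi₁, hi₂, hi₃, hp, hn⟩ := (μ.restrict (piece X n) (measurableSet_piece n)
      (piece_subset_isCompact n)).toJordanDecomposition_spec
    refine ⟨i, hi₁, fun A hA => ?_⟩
    have e : ∀ S, MeasurableSet S → μ.restrict (piece X n) (measurableSet_piece n)
      (piece_subset_isCompact n) S = μ (S ∩ piece X n) := fun S hS => if_pos hS
    have e1 := SignedMeasure.toMeasureOfZeroLE_real_apply _ hi₂ hi₁ hA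
    have e2 := SignedMeasure.toMeasureOfLEZero_real_apply _ hi₃ hi₁.compl hA
    rw [e _ (hi₁.inter hA)] at e1
    rw [e _ (hi₁.compl.inter hA)] at e2
    refine ⟨e1 ▸ measureReal_nonneg, ?_, ?_, ?_⟩
    · unfold jordanPiece
      rw [hp, ← e1, ofReal_measureReal]
    · have : 0 ≤ -μ (iᶜ ∩ A ∩ piece X n) := e2 ▸ measureReal_nonneg
      linarith
    · unfold jordanPiece
      rw [hn, ← e2, ofReal_measureReal]
  choose i hi h using hpiece
  -- Hahn sets of the disjoint pieces are glued. For bounded `A` the resulting series converge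
  -- because `closure A` is compact.
  refine ⟨⋃ n, i n ∩ piece X n, MeasurableSet.iUnion fun n => (hi n).inter (measurableSet_piece n),
    fun A hA hb => ?_⟩
  have hdisj : ∀ j : ℕ → Set X,
      Pairwise (Function.onFun Disjoint fun n => j n ∩ A ∩ piece X n) := fun j m n hmn =>
    (disjoint_piece X hmn).mono inter_subset_right inter_subset_right
  have hsum : ∀ j : ℕ → Set X, (∀ n, MeasurableSet (j n)) →
      HasSum (fun n => μ (j n ∩ A ∩ piece X n)) (μ (⋃ n, j n ∩ A ∩ piece X n)) := fun j hj =>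
    μ.hasSum' (closure A) hb.isCompact_closure _
      (fun n => ((hj n).inter hA).inter (measurableSet_piece n))
      (fun n => (inter_subset_left.trans inter_subset_right).trans subset_closure) (hdisj j)
  have e1 : A ∩ ⋃ n, i n ∩ piece X n = ⋃ n, i n ∩ A ∩ piece X n := by
    rw [inter_iUnion]
    congr 1; funext n; ext x; simp only [mem_inter_iff]; tauto
  have e2 : A \ ⋃ n, i n ∩ piece X n = ⋃ n, (i n)ᶜ ∩ A ∩ piece X n := by
    ext x
    obtain ⟨m, hm⟩ : ∃ m, x ∈ piece X m := by
      have := mem_univ x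
      rw [← iUnion_piece X] at this
      exact mem_iUnion.1 this
    have huniq : ∀ n, x ∈ piece X n → n = m := fun n hn => by
      by_contra hne
      exact disjoint_left.1 (disjoint_piece X hne) hn hm
    simp only [Set.mem_sdiff, mem_iUnion, mem_inter_iff, mem_compl_iff, not_exists, not_and]
    constructor
    · rintro ⟨hxA, hx⟩
      exact ⟨m, ⟨fun hxi => hx m hxi hm, hxA⟩, hm⟩
    · rintro ⟨n, ⟨hxi, hxA⟩, hn⟩
      refine ⟨hxA, fun k hk hk' => hxi ?_⟩
      rw [huniq n hn, ← huniq k hk']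
      exact hk
  have s1 := hsum i hi
  have s2 := (hsum (fun n => (i n)ᶜ) fun n => (hi n).compl).neg
  rw [e1, e2]
  refine ⟨s1.nonneg fun n => (h n A hA).1, ?_, ?_, ?_⟩
  · rw [posPart, Measure.sum_apply _ hA, ← s1.tsum_eq,
      ENNReal.ofReal_tsum_of_nonneg (fun n => (h n A hA).1) s1.summable]
    exact tsum_congr fun n => (h n A hA).2.1
  · have := s2.nonneg fun n => neg_nonneg.2 (h n A hA).2.2.1
    linarith
  · rw [negPart, Measure.sum_apply _ hA, ← s2.tsum_eq,
      ENNReal.ofReal_tsum_of_nonneg (fun n => neg_nonneg.2 (h n A hA).2.2.1) s2.summable]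
    exact tsum_congr fun n => (h n A hA).2.2.2

theorem posPart_lt_top (μ : LocMeasure X) {A : Set X} (hb : Bornology.IsBounded A) :
    μ.posPart A < ⊤ := by
  obtain ⟨H, -, h⟩ := μ.exists_hahn
  refine (measure_mono subset_closure).trans_lt ?_
  rw [(h _ isClosed_closure.measurableSet hb.closure).2.1]
  exact ENNReal.ofReal_lt_top

theorem negPart_lt_top (μ : LocMeasure X) {A : Set X} (hb : Bornology.IsBounded A) :
    μ.negPart A < ⊤ := by
  obtain ⟨H, -, h⟩ := μ.exists_hahn
  refine (measure_mono subset_closure).trans_lt ?_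
  rw [(h _ isClosed_closure.measurableSet hb.closure).2.2.2]
  exact ENNReal.ofReal_lt_top

theorem variation_lt_top (μ : LocMeasure X) {A : Set X} (hb : Bornology.IsBounded A) :
    μ.variation A < ⊤ :=
  ENNReal.add_lt_top.2 ⟨μ.posPart_lt_top hb, μ.negPart_lt_top hb⟩

theorem apply_eq_sub (μ : LocMeasure X) {A : Set X} (hA : MeasurableSet A)
    (hb : Bornology.IsBounded A) : μ A = μ.posPart.real A - μ.negPart.real A := by
  obtain ⟨H, hH, h⟩ := μ.exists_hahn
  obtain ⟨h1, h2, h3, h4⟩ := h A hA hb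
  rw [measureReal_def, measureReal_def, h2, h4, ENNReal.toReal_ofReal h1,
    ENNReal.toReal_ofReal (by linarith), ← μ.apply_inter_add_diff hA hb hH]
  ring

/-- Two representations of `μ` on the Borel subsets of `B` as differences of finite measures. -/
theorem restrict_posPart_add (μ : LocMeasure X) {B : Set X} (hB : MeasurableSet B)
    (hb : Bornology.IsBounded B) {α β : Measure X} (hα : α B < ⊤) (hβ : β B < ⊤)
    (h : ∀ A, MeasurableSet A → A ⊆ B → μ A = α.real A - β.real A) :
    (μ.posPart + β).restrict B = (μ.negPart + α).restrict B := by
  refine Measure.ext fun A hA => ?_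
  rw [Measure.restrict_apply hA, Measure.restrict_apply hA, Measure.add_apply, Measure.add_apply]
  have hsub : A ∩ B ⊆ B := inter_subset_right
  have h1 := h (A ∩ B) (hA.inter hB) hsub
  rw [μ.apply_eq_sub (hA.inter hB) (hb.subset hsub)] at h1
  have f1 := (μ.posPart_lt_top (hb.subset hsub)).ne
  have f2 := (μ.negPart_lt_top (hb.subset hsub)).ne
  have f3 := ((measure_mono hsub).trans_lt hα).ne
  have f4 := ((measure_mono hsub).trans_lt hβ).ne
  rw [← ENNReal.toReal_eq_toReal_iff' (ENNReal.add_ne_top.2 ⟨f1, f4⟩)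
    (ENNReal.add_ne_top.2 ⟨f2, f3⟩), ENNReal.toReal_add f1 f4, ENNReal.toReal_add f2 f3]
  simp only [measureReal_def] at h1
  linarith

/-- Minimality of the Jordan decomposition: with a Hahn set `H`, `μ⁺(A) = μ(A ∩ H) ≤ α(A ∩ H) ≤
α(A)`. -/
theorem restrict_posPart_le (μ : LocMeasure X) {B : Set X} (hB : MeasurableSet B)
    (hb : Bornology.IsBounded B) {α β : Measure X}
    (h : ∀ A, MeasurableSet A → A ⊆ B → μ A = α.real A - β.real A) :
    μ.posPart.restrict B ≤ α.restrict B := by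
  obtain ⟨H, hH, hH'⟩ := μ.exists_hahn
  refine Measure.le_iff.2 fun A hA => ?_
  rw [Measure.restrict_apply hA, Measure.restrict_apply hA]
  have hsub : A ∩ B ⊆ B := inter_subset_right
  rw [(hH' _ (hA.inter hB) (hb.subset hsub)).2.1,
    h _ ((hA.inter hB).inter hH) (inter_subset_left.trans hsub)]
  refine (ENNReal.ofReal_le_ofReal (sub_le_self _ measureReal_nonneg)).trans ?_
  refine ENNReal.ofReal_toReal_le.trans (measure_mono inter_subset_left)

theorem restrict_negPart_le (μ : LocMeasure X) {B : Set X} (hB : MeasurableSet B)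
    (hb : Bornology.IsBounded B) {α β : Measure X}
    (h : ∀ A, MeasurableSet A → A ⊆ B → μ A = α.real A - β.real A) :
    μ.negPart.restrict B ≤ β.restrict B := by
  obtain ⟨H, hH, hH'⟩ := μ.exists_hahn
  refine Measure.le_iff.2 fun A hA => ?_
  rw [Measure.restrict_apply hA, Measure.restrict_apply hA]
  have hsub : A ∩ B ⊆ B := inter_subset_right
  rw [(hH' _ (hA.inter hB) (hb.subset hsub)).2.2.2,
    h _ ((hA.inter hB).diff hH) (sdiff_subset.trans hsub), neg_sub]
  refine (ENNReal.ofReal_le_ofReal (sub_le_self _ measureReal_nonneg)).trans ?_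
  refine ENNReal.ofReal_toReal_le.trans (measure_mono sdiff_subset)

theorem integral_eq_setIntegral (μ : LocMeasure X) {B : Set X} {g : X → ℝ}
    (hg : ∀ x, x ∉ B → g x = 0) :
    μ.integral g = (∫ x in B, g x ∂μ.posPart) - ∫ x in B, g x ∂μ.negPart := by
  rw [integral, setIntegral_eq_integral_of_forall_compl_eq_zero hg,
    setIntegral_eq_integral_of_forall_compl_eq_zero hg]

/-- Integrate `g` against the identity `μ⁺ + β = μ⁻ + α` on `B`; minimality of the parts gives the
integrability needed to rearrange it. -/
theorem integral_eq_sub (μ : LocMeasure X) {B : Set X} (hB : MeasurableSet B)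
    (hb : Bornology.IsBounded B) {α β : Measure X} (hα : α B < ⊤) (hβ : β B < ⊤)
    (h : ∀ A, MeasurableSet A → A ⊆ B → μ A = α.real A - β.real A) {g : X → ℝ}
    (hg : ∀ x, x ∉ B → g x = 0) (hgα : IntegrableOn g B α) (hgβ : IntegrableOn g B β) :
    μ.integral g = (∫ x in B, g x ∂α) - ∫ x in B, g x ∂β := by
  have hP : IntegrableOn g B μ.posPart :=
    Integrable.mono_measure hgα (μ.restrict_posPart_le hB hb h)
  have hN : IntegrableOn g B μ.negPart :=
    Integrable.mono_measure hgβ (μ.restrict_negPart_le hB hb h)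
  have key := congrArg (fun m => ∫ x, g x ∂m) (μ.restrict_posPart_add hB hb hα hβ h)
  simp only [Measure.restrict_add] at key
  rw [integral_add_measure hP hgβ, integral_add_measure hN hgα] at key
  rw [μ.integral_eq_setIntegral hg]
  linarith

/-- The Jordan parts of a difference are not differences of Jordan parts, but `μ₁⁺ + μ₂⁻` and `μ₁⁻ +
μ₂⁺` represent `μ₁ - μ₂`, which suffices for integration. -/
theorem integral_sub (μ₁ μ₂ : LocMeasure X) {B : Set X} (hB : MeasurableSet B)
    (hb : Bornology.IsBounded B) {g : X → ℝ} (hg : ∀ x, x ∉ B → g x = 0)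
    (h₁ : IntegrableOn g B μ₁.variation) (h₂ : IntegrableOn g B μ₂.variation) :
    (μ₁ - μ₂).integral g = μ₁.integral g - μ₂.integral g := by
  unfold variation at h₁ h₂
  rw [IntegrableOn, Measure.restrict_add, integrable_add_measure] at h₁ h₂
  have hP : IntegrableOn g B (μ₁.posPart + μ₂.negPart) := by
    rw [IntegrableOn, Measure.restrict_add, integrable_add_measure]; exact ⟨h₁.1, h₂.2⟩
  have hN : IntegrableOn g B (μ₁.negPart + μ₂.posPart) := by
    rw [IntegrableOn, Measure.restrict_add, integrable_add_measure]; exact ⟨h₁.2, h₂.1⟩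
  rw [(μ₁ - μ₂).integral_eq_sub hB hb
    (ENNReal.add_lt_top.2 ⟨μ₁.posPart_lt_top hb, μ₂.negPart_lt_top hb⟩)
    (ENNReal.add_lt_top.2 ⟨μ₁.negPart_lt_top hb, μ₂.posPart_lt_top hb⟩) (fun A hA hAB => ?_)
    hg hP hN, μ₁.integral_eq_setIntegral hg, μ₂.integral_eq_setIntegral hg]
  · rw [Measure.restrict_add, Measure.restrict_add, integral_add_measure h₁.1 h₂.2,
      integral_add_measure h₁.2 h₂.1]
    ring
  · have hbA := hb.subset hAB
    rw [sub_apply, μ₁.apply_eq_sub hA hbA, μ₂.apply_eq_sub hA hbA,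
      measureReal_add_apply (μ₁.posPart_lt_top hbA).ne (μ₂.negPart_lt_top hbA).ne,
      measureReal_add_apply (μ₁.negPart_lt_top hbA).ne (μ₂.posPart_lt_top hbA).ne]
    ring

theorem enorm_integral_le (μ : LocMeasure X) (g : X → ℝ) :
    ‖μ.integral g‖ₑ ≤ ∫⁻ x, ‖g x‖ₑ ∂μ.variation := by
  rw [variation, lintegral_add_measure]
  exact enorm_sub_le.trans
    (add_le_add (enorm_integral_le_lintegral_enorm _) (enorm_integral_le_lintegral_enorm _))

theorem integral_indicator_one (μ : LocMeasure X) {A : Set X} (hA : MeasurableSet A)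
    (hb : Bornology.IsBounded A) : μ.integral (A.indicator fun _ => 1) = μ A := by
  rw [integral, μ.apply_eq_sub hA hb, integral_indicator_const _ hA,
    integral_indicator_const _ hA]
  simp

end LocMeasure

/-! ### Disintegration in time of a measure given by a family -/

open ProbabilityTheory

/-- Finite intersections of a countable basis; the empty intersection contributes `univ`.
Countability lets almost-everywhere statements about single sets be combined. -/
theorem exists_countable_isOpen_piSystem (X : Type*) [TopologicalSpace X]
    [SecondCountableTopology X] [MeasurableSpace X] [BorelSpace X] : ∃ C : Set (Set X),
    C.Countable ∧ IsPiSystem C ∧ ‹MeasurableSpace X› = MeasurableSpace.generateFrom C ∧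
      (∀ s ∈ C, IsOpen s) ∧ univ ∈ C := by
  have hbasis := TopologicalSpace.isBasis_countableBasis X
  have hC := TopologicalSpace.countable_countableBasis X
  have hopen : ∀ s ∈ sInter '' {F : Set (Set X) | F.Finite ∧
      F ⊆ TopologicalSpace.countableBasis X}, IsOpen s := by
    rintro _ ⟨F, ⟨hF, hF'⟩, rfl⟩
    exact hF.isOpen_sInter fun s hs => hbasis.isOpen (hF' hs)
  refine ⟨_, (countable_ofPred_finite_subset hC).image _, ?_, ?_, hopen,
    ⟨∅, ⟨finite_empty, empty_subset _⟩, sInter_empty⟩⟩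
  · rintro _ ⟨F, ⟨hF, hF'⟩, rfl⟩ _ ⟨G, ⟨hG, hG'⟩, rfl⟩ -
    exact ⟨F ∪ G, ⟨hF.union hG, union_subset hF' hG'⟩, sInter_union F G⟩
  · refine le_antisymm ?_ (MeasurableSpace.generateFrom_le fun s hs => (hopen s hs).measurableSet)
    rw [BorelSpace.measurable_eq (α := X), hbasis.borel_eq_generateFrom]
    exact MeasurableSpace.generateFrom_mono fun s hs =>
      ⟨{s}, ⟨finite_singleton s, singleton_subset_iff.2 hs⟩, sInter_singleton s⟩

/-- The conditional kernel of `ρ` is multiplied by the density of the time marginal, which turns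
disintegration over `ρ.fst` into disintegration over `lam`. -/
theorem exists_kernel_of_fst_absolutelyContinuous {Ω : Type*} [MeasurableSpace Ω]
    [StandardBorelSpace Ω] [Nonempty Ω] (ρ : Measure (ℝ × Ω)) [IsFiniteMeasure ρ]
    (lam : Measure ℝ) [SigmaFinite lam] (h : ρ.fst ≪ lam) :
    ∃ κ : Kernel ℝ Ω, IsSFiniteKernel κ ∧ (∀ t, IsFiniteMeasure (κ t)) ∧ lam ⊗ₘ κ = ρ := by
  -- Replacing the value `∞` of the density by `0` makes every `κ t` finite and alters the density
  -- only on a null set.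
  let p : ℝ → Ω → NNReal := fun t _ => (ρ.fst.rnDeriv lam t).toNNReal
  have hp : Measurable (Function.uncurry fun t x => (p t x : ℝ≥0∞)) :=
    ((Measure.measurable_rnDeriv _ _).ennreal_toNNReal.coe_nnreal_ennreal).comp measurable_fst
  have happ : ∀ t s, (ρ.condKernel.withDensity fun t x => (p t x : ℝ≥0∞)) t s =
      (ρ.fst.rnDeriv lam t).toNNReal * ρ.condKernel t s := by
    intro t s
    rw [Kernel.withDensity_apply' _ hp]
    simp [p]
  refine ⟨ρ.condKernel.withDensity fun t x => (p t x : ℝ≥0∞), inferInstance,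
    fun t => ⟨?_⟩, ?_⟩
  · rw [happ]
    exact ENNReal.mul_lt_top ENNReal.coe_lt_top (measure_lt_top _ _)
  · conv_rhs => rw [← ρ.disintegrate ρ.condKernel]
    refine Measure.ext fun s hs => ?_
    rw [Measure.compProd_apply hs, Measure.compProd_apply hs]
    simp_rw [happ]
    rw [← lintegral_rnDeriv_mul h (Kernel.measurable_kernel_prodMk_left hs).aemeasurable]
    refine lintegral_congr_ae ?_
    filter_upwards [Measure.rnDeriv_lt_top ρ.fst lam] with t ht
    rw [ENNReal.coe_toNNReal ht.ne]

section Disintegration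

variable {d : ℕ}

local notation "E" => EuclideanSpace ℝ (Fin d)

theorem measurableEmbedding_prodMap_coe (T : ℝ) : MeasurableEmbedding
    (fun p : EuclideanSpace ℝ (Fin d) × Icc (0 : ℝ) T => (p.1, (p.2 : ℝ))) :=
  MeasurableEmbedding.id.prodMap (MeasurableEmbedding.subtype_coe measurableSet_Icc)

namespace IsGivenBy

theorem apply_preimage {T : ℝ} {M : LocMeasure (E × Icc (0 : ℝ) T)} {μ : ℝ → LocMeasure E}
    (h : IsGivenBy T M μ) {Q : Set (E × ℝ)} (hQ : MeasurableSet Q) {R : ℝ}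
    (hR : ∀ p ∈ Q, ‖p.1‖ ≤ R) :
    M ((fun p : E × Icc (0 : ℝ) T => (p.1, (p.2 : ℝ))) ⁻¹' Q) =
      ∫ t in Icc 0 T, μ t ((fun x => (x, t)) ⁻¹' Q) := by
  have h1 := h.integral_eq (Q.indicator fun _ => 1) (measurable_const.indicator hQ)
    ⟨1, fun p => by
      by_cases hp : p ∈ Q <;> simp [hp]⟩
    ⟨R, fun x t hx => indicator_of_notMem (fun hp => absurd (hR (x, t) hp) (not_le.2 hx)) _⟩
  have hb : Bornology.IsBounded ((fun p : E × Icc (0 : ℝ) T => (p.1, (p.2 : ℝ))) ⁻¹' Q) :=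
    ((Metric.isBounded_closedBall (x := (0 : E)) (r := R)).prod
      (isCompact_univ (X := Icc (0 : ℝ) T)).isBounded).subset fun p hp =>
        ⟨mem_closedBall_zero_iff.2 (hR (p.1, (p.2 : ℝ)) hp), mem_univ _⟩
  have hslice : ∀ t, Bornology.IsBounded ((fun x : E => (x, t)) ⁻¹' Q) := fun t =>
    (Metric.isBounded_closedBall (x := (0 : E)) (r := R)).subset fun x hx =>
      mem_closedBall_zero_iff.2 (hR (x, t) hx)
  rw [← M.integral_indicator_one ((measurableEmbedding_prodMap_coe T).measurable hQ) hb]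
  refine h1.trans (integral_congr_ae (Eventually.of_forall fun t => ?_))
  exact (μ t).integral_indicator_one (measurable_prodMk_right hQ) (hslice t)

theorem apply_eq {T : ℝ} {M : LocMeasure (E × Icc (0 : ℝ) T)} {μ : ℝ → LocMeasure E}
    (h : IsGivenBy T M μ) {A : Set (E × Icc (0 : ℝ) T)} (hA : MeasurableSet A)
    (hb : Bornology.IsBounded A) :
    M A = ∫ t in Icc 0 T, μ t ((fun x => (x, t)) ⁻¹' ((fun p : E × Icc (0 : ℝ) T =>
      (p.1, (p.2 : ℝ))) '' A)) := by
  obtain ⟨R, hR⟩ := ((LipschitzWith.prod_fst (α := E) (β := Icc (0 : ℝ) T)).isBounded_image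
    hb).exists_norm_le
  rw [← h.apply_preimage ((measurableEmbedding_prodMap_coe T).measurableSet_image.2 hA) (R := R)
    (by rintro _ ⟨p, hp, rfl⟩; exact hR _ ⟨p, hp, rfl⟩),
    (measurableEmbedding_prodMap_coe T).injective.preimage_image]

theorem apply_eq_zero_of_null {T : ℝ} {M : LocMeasure (E × Icc (0 : ℝ) T)}
    {μ : ℝ → LocMeasure E} (h : IsGivenBy T M μ) {S : Set ℝ}
    (hS : volume.restrict (Icc 0 T) S = 0) {A : Set (E × Icc (0 : ℝ) T)} (hA : MeasurableSet A)
    (hb : Bornology.IsBounded A) (hAS : ∀ p ∈ A, (p.2 : ℝ) ∈ S) : M A = 0 := by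
  rw [h.apply_eq hA hb]
  refine integral_eq_zero_of_ae ?_
  filter_upwards [measure_eq_zero_iff_ae_notMem.1 hS] with t ht
  have : (fun x => (x, t)) ⁻¹' ((fun p : E × Icc (0 : ℝ) T => (p.1, (p.2 : ℝ))) '' A) = ∅ := by
    refine eq_empty_of_forall_notMem ?_
    rintro x ⟨p, hp, hpx⟩
    refine ht ?_
    have := hAS p hp
    rwa [show (p.2 : ℝ) = t from congrArg Prod.snd hpx] at this
  rw [this, LocMeasure.apply_empty]
  rfl

theorem integrable_apply {T : ℝ} {M : LocMeasure (E × Icc (0 : ℝ) T)} {μ : ℝ → LocMeasure E}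
    (h : IsGivenBy T M μ) {A : Set E} (hA : MeasurableSet A) (hb : Bornology.IsBounded A) :
    IntegrableOn (fun t => μ t A) (Icc 0 T) := by
  refine Integrable.mono (h.integrable _ hb.isCompact_closure)
    (h.measurable A hA hb).aestronglyMeasurable
    (Eventually.of_forall fun t => ?_)
  have h1 : (μ t).variation.real A ≤ (μ t).variation.real (closure A) :=
    measureReal_mono subset_closure ((μ t).variation_lt_top hb.closure).ne
  have h2 : (μ t).variation.real A = (μ t).posPart.real A + (μ t).negPart.real A :=
    measureReal_add_apply ((μ t).posPart_lt_top hb).ne ((μ t).negPart_lt_top hb).ne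
  have h3 : 0 ≤ (μ t).posPart.real A := measureReal_nonneg
  have h4 : 0 ≤ (μ t).negPart.real A := measureReal_nonneg
  rw [Real.norm_eq_abs, Real.norm_of_nonneg measureReal_nonneg, (μ t).apply_eq_sub hA hb, abs_le]
  constructor <;> linarith

end IsGivenBy

/-- The map `(x, t) ↦ (t, x)` from `ℝᵈ × [0, T]` to `ℝ × ℝᵈ`. -/
def swapTime (T : ℝ) (p : E × Icc (0 : ℝ) T) : ℝ × E := ((p.2 : ℝ), p.1)

theorem measurable_swapTime (T : ℝ) : Measurable (swapTime (d := d) T) :=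
  (measurable_subtype_coe.comp measurable_snd).prodMk measurable_fst

theorem measurableEmbedding_swapTime (T : ℝ) : MeasurableEmbedding (swapTime (d := d) T) :=
  MeasurableEquiv.prodComm.measurableEmbedding.comp (measurableEmbedding_prodMap_coe T)

theorem isBounded_prod_univ {T : ℝ} {B : Set E} (hb : Bornology.IsBounded B) :
    Bornology.IsBounded (B ×ˢ (univ : Set (Icc (0 : ℝ) T))) :=
  hb.prod isCompact_univ.isBounded

/-- Disintegration of the positive and negative parts of `M` over a bounded set `B`. -/
theorem IsGivenBy.exists_kernels {T : ℝ} {M : LocMeasure (E × Icc (0 : ℝ) T)}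
    {μ : ℝ → LocMeasure E} (h : IsGivenBy T M μ) {B : Set E} (hB : MeasurableSet B)
    (hb : Bornology.IsBounded B) : ∃ α β : Kernel ℝ E, IsSFiniteKernel α ∧ IsSFiniteKernel β ∧
      (∀ t, IsFiniteMeasure (α t)) ∧ (∀ t, IsFiniteMeasure (β t)) ∧
      volume.restrict (Icc 0 T) ⊗ₘ α = (M.posPart.restrict (B ×ˢ univ)).map (swapTime T) ∧
      volume.restrict (Icc 0 T) ⊗ₘ β = (M.negPart.restrict (B ×ˢ univ)).map (swapTime T) ∧
      ∀ᵐ t ∂volume.restrict (Icc 0 T), ∀ A, MeasurableSet A → A ⊆ B →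
        μ t A = (α t).real A - (β t).real A := by
  have hbu := isBounded_prod_univ (T := T) hb
  have hBu : MeasurableSet (B ×ˢ (univ : Set (Icc (0 : ℝ) T))) := hB.prod MeasurableSet.univ
  obtain ⟨H, hH, hH'⟩ := M.exists_hahn
  have hfinP : IsFiniteMeasure (M.posPart.restrict (B ×ˢ univ)) :=
    ⟨by rw [Measure.restrict_apply_univ]; exact M.posPart_lt_top hbu⟩
  have hfinN : IsFiniteMeasure (M.negPart.restrict (B ×ˢ univ)) :=
    ⟨by rw [Measure.restrict_apply_univ]; exact M.negPart_lt_top hbu⟩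
  -- `M` vanishes on bounded sets lying over a null set of times; intersecting with a Hahn set
  -- passes this to both parts.
  have hnull : ∀ S : Set ℝ, MeasurableSet S → volume.restrict (Icc 0 T) S = 0 →
      ∀ A : Set (E × Icc (0 : ℝ) T), MeasurableSet A → Bornology.IsBounded A →
        (∀ p ∈ A, (p.2 : ℝ) ∈ S) → M.posPart A = 0 ∧ M.negPart A = 0 := by
    intro S hS hS0 A hA hbA hAS
    obtain ⟨-, h2, -, h4⟩ := hH' A hA hbA
    rw [h2, h4, h.apply_eq_zero_of_null hS0 (hA.inter hH) (hbA.subset inter_subset_left)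
      (fun p hp => hAS p hp.1), h.apply_eq_zero_of_null hS0 (hA.diff hH)
      (hbA.subset sdiff_subset) (fun p hp => hAS p hp.1)]
    simp
  have hac : ∀ m : Measure (E × Icc (0 : ℝ) T), (∀ S : Set ℝ, MeasurableSet S →
      volume.restrict (Icc 0 T) S = 0 → ∀ A : Set (E × Icc (0 : ℝ) T), MeasurableSet A →
        Bornology.IsBounded A → (∀ p ∈ A, (p.2 : ℝ) ∈ S) → m A = 0) →
      ((m.restrict (B ×ˢ univ)).map (swapTime T)).fst ≪ volume.restrict (Icc 0 T) := by
    intro m hm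
    refine Measure.AbsolutelyContinuous.mk fun S hS hS0 => ?_
    have hS' : MeasurableSet (swapTime T ⁻¹' (Prod.fst ⁻¹' S) : Set (E × Icc (0 : ℝ) T)) :=
      measurable_swapTime T (measurable_fst hS)
    rw [Measure.fst_apply hS, Measure.map_apply (measurable_swapTime T) (measurable_fst hS),
      Measure.restrict_apply hS']
    exact hm S hS hS0 _ (hS'.inter hBu) (hbu.subset inter_subset_right) fun p hp => hp.1
  obtain ⟨α, hα1, hα2, hα⟩ := exists_kernel_of_fst_absolutelyContinuous
    ((M.posPart.restrict (B ×ˢ univ)).map (swapTime T)) (volume.restrict (Icc 0 T))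
    (hac _ fun S hS hS0 A hA hbA hAS => (hnull S hS hS0 A hA hbA hAS).1)
  obtain ⟨β, hβ1, hβ2, hβ⟩ := exists_kernel_of_fst_absolutelyContinuous
    ((M.negPart.restrict (B ×ˢ univ)).map (swapTime T)) (volume.restrict (Icc 0 T))
    (hac _ fun S hS hS0 A hA hbA hAS => (hnull S hS hS0 A hA hbA hAS).2)
  refine ⟨α, β, hα1, hβ1, hα2, hβ2, hα, hβ, ?_⟩
  have hset : ∀ (S : Set ℝ) (A : Set E), A ⊆ B → swapTime T ⁻¹' (S ×ˢ A) ∩ B ×ˢ univ =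
      (fun p : E × Icc (0 : ℝ) T => (p.1, (p.2 : ℝ))) ⁻¹' (A ×ˢ S) := by
    intro S A hAB
    ext p
    simp only [swapTime, mem_inter_iff, mem_preimage, mem_prod, mem_univ, and_true]
    exact ⟨fun hp => ⟨hp.1.2, hp.1.1⟩, fun hp => ⟨⟨hp.2, hp.1⟩, hAB hp.1⟩⟩
  -- mass of rectangles
  have hrect : ∀ (m : Measure (E × Icc (0 : ℝ) T)) (κ : Kernel ℝ E), IsSFiniteKernel κ →
      volume.restrict (Icc 0 T) ⊗ₘ κ = (m.restrict (B ×ˢ univ)).map (swapTime T) →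
      ∀ (S : Set ℝ) (A : Set E), MeasurableSet S → MeasurableSet A → A ⊆ B →
      ∫⁻ t in S, κ t A ∂volume.restrict (Icc 0 T) =
        m ((fun p : E × Icc (0 : ℝ) T => (p.1, (p.2 : ℝ))) ⁻¹' (A ×ˢ S)) := by
    intro m κ _ hκ S A hS hA hAB
    rw [← Measure.compProd_apply_prod hS hA, hκ, Measure.map_apply (measurable_swapTime T)
      (hS.prod hA), Measure.restrict_apply (measurable_swapTime T (hS.prod hA)), hset S A hAB]
  have hsub : ∀ (S : Set ℝ) (A : Set E), A ⊆ B →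
      (fun p : E × Icc (0 : ℝ) T => (p.1, (p.2 : ℝ))) ⁻¹' (A ×ˢ S) ⊆ B ×ˢ univ :=
    fun S A hAB p hp => ⟨hAB hp.1, trivial⟩
  -- For fixed `A` both sides have the same integral over every measurable set `S` of times, namely
  -- `M (A × S)`. The null set depends on `A`, hence the passage to a countable π-system afterwards.
  have hae : ∀ A, MeasurableSet A → A ⊆ B → ∀ᵐ t ∂volume.restrict (Icc 0 T),
      μ t A = (α t).real A - (β t).real A := by
    intro A hA hAB
    have hbA := hb.subset hAB
    obtain ⟨R, hR⟩ := hbA.exists_norm_le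
    have hI : ∀ (κ : Kernel ℝ E), (∫⁻ t in univ, κ t A ∂volume.restrict (Icc 0 T)) ≠ ⊤ →
        Integrable (fun t => (κ t).real A) (volume.restrict (Icc 0 T)) := by
      intro κ hκ
      rw [Measure.restrict_univ] at hκ
      exact integrable_toReal_of_lintegral_ne_top (κ.measurable_coe hA).aemeasurable hκ
    have hIα := hI α (by
      rw [hrect _ α hα1 hα univ A MeasurableSet.univ hA hAB]
      exact (M.posPart_lt_top (hbu.subset (hsub _ _ hAB))).ne)
    have hIβ := hI β (by
      rw [hrect _ β hβ1 hβ univ A MeasurableSet.univ hA hAB]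
      exact (M.negPart_lt_top (hbu.subset (hsub _ _ hAB))).ne)
    refine Integrable.ae_eq_of_forall_setIntegral_eq _ _ (h.integrable_apply hA hbA)
      (hIα.sub hIβ) fun S hS _ => ?_
    have hR' : ∀ p ∈ A ×ˢ S, ‖p.1‖ ≤ R := fun p hp => hR _ hp.1
    have h1 := h.apply_preimage (hA.prod hS) hR'
    have e1 : ∀ t, μ t ((fun x => (x, t)) ⁻¹' (A ×ˢ S)) = S.indicator (fun t => μ t A) t := by
      intro t
      by_cases ht : t ∈ S
      · rw [indicator_of_mem ht, mk_preimage_prod_left ht]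
      · rw [indicator_of_notMem ht, mk_preimage_prod_left_eq_empty ht, LocMeasure.apply_empty]
    simp_rw [e1] at h1
    rw [integral_indicator hS] at h1
    rw [← h1, M.apply_eq_sub ((measurableEmbedding_prodMap_coe T).measurable (hA.prod hS))
      (hbu.subset (hsub _ _ hAB)), measureReal_def, measureReal_def,
      ← hrect _ α hα1 hα S A hS hA hAB, ← hrect _ β hβ1 hβ S A hS hA hAB]
    have hsubint := integral_sub (μ := (volume.restrict (Icc 0 T)).restrict S)
      hIα.restrict hIβ.restrict
    rw [hsubint]
    congr 1
    · exact (integral_toReal (α.measurable_coe hA).aemeasurable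
        (Eventually.of_forall fun t => measure_lt_top _ _)).symm
    · exact (integral_toReal (β.measurable_coe hA).aemeasurable
        (Eventually.of_forall fun t => measure_lt_top _ _)).symm
  obtain ⟨C, hCc, hCpi, hCgen, hCo, hCu⟩ := exists_countable_isOpen_piSystem E
  have hall : ∀ᵐ t ∂volume.restrict (Icc 0 T), ∀ O ∈ C,
      μ t (O ∩ B) = (α t).real (O ∩ B) - (β t).real (O ∩ B) :=
    (ae_ball_iff hCc).2 fun O hO => hae _ ((hCo O hO).measurableSet.inter hB) inter_subset_right
  filter_upwards [hall] with t ht A hA hAB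
  have hf1 : IsFiniteMeasure ((μ t).posPart.restrict B) :=
    ⟨by rw [Measure.restrict_apply_univ]; exact (μ t).posPart_lt_top hb⟩
  have hf2 : IsFiniteMeasure ((μ t).negPart.restrict B) :=
    ⟨by rw [Measure.restrict_apply_univ]; exact (μ t).negPart_lt_top hb⟩
  -- The signed identity is rearranged into an equality of finite positive measures, which a
  -- generating π-system determines.
  have hC : ∀ O ∈ C, ((μ t).posPart.restrict B + (β t).restrict B) O =
      ((μ t).negPart.restrict B + (α t).restrict B) O := by
    intro O hO
    have hOm := (hCo O hO).measurableSet
    have h1 := ht O hO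
    have hbO : Bornology.IsBounded (O ∩ B) := hb.subset inter_subset_right
    rw [(μ t).apply_eq_sub (hOm.inter hB) hbO] at h1
    simp only [Measure.add_apply, Measure.restrict_apply hOm]
    have f1 := ((μ t).posPart_lt_top hbO).ne
    have f2 := ((μ t).negPart_lt_top hbO).ne
    have f3 := measure_ne_top (α t) (O ∩ B)
    have f4 := measure_ne_top (β t) (O ∩ B)
    rw [← ENNReal.toReal_eq_toReal_iff' (ENNReal.add_ne_top.2 ⟨f1, f4⟩)
      (ENNReal.add_ne_top.2 ⟨f2, f3⟩), ENNReal.toReal_add f1 f4, ENNReal.toReal_add f2 f3]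
    simp only [measureReal_def] at h1
    linarith
  have hm := ext_of_generate_finite C hCgen hCpi hC (hC univ hCu)
  have hmA := congrArg (fun m => m A) hm
  simp only [Measure.add_apply, Measure.restrict_apply hA, inter_eq_left.2 hAB] at hmA
  have hbA := hb.subset hAB
  have f1 := ((μ t).posPart_lt_top hbA).ne
  have f2 := ((μ t).negPart_lt_top hbA).ne
  have f3 := measure_ne_top (α t) A
  have f4 := measure_ne_top (β t) A
  rw [← ENNReal.toReal_eq_toReal_iff' (ENNReal.add_ne_top.2 ⟨f1, f4⟩)
      (ENNReal.add_ne_top.2 ⟨f2, f3⟩), ENNReal.toReal_add f1 f4, ENNReal.toReal_add f2 f3] at hmA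
  rw [(μ t).apply_eq_sub hA hbA]
  simp only [measureReal_def]
  linarith

end Disintegration

namespace LocMeasure

variable {X : Type*} [MetricSpace X] [ProperSpace X] [MeasurableSpace X] [BorelSpace X]

instance (μ : LocMeasure X) : IsFiniteMeasureOnCompacts μ.posPart :=
  ⟨fun _ hK => μ.posPart_lt_top hK.isBounded⟩

instance (μ : LocMeasure X) : IsFiniteMeasureOnCompacts μ.negPart :=
  ⟨fun _ hK => μ.negPart_lt_top hK.isBounded⟩

instance (μ : LocMeasure X) : IsFiniteMeasureOnCompacts μ.variation :=
  ⟨fun _ hK => μ.variation_lt_top hK.isBounded⟩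

theorem integral_sub_fun (μ : LocMeasure X) {f g : X → ℝ} (hf : Continuous f)
    (hfc : HasCompactSupport f) (hg : Continuous g) (hgc : HasCompactSupport g) :
    μ.integral (fun x => f x - g x) = μ.integral f - μ.integral g := by
  unfold integral
  rw [MeasureTheory.integral_sub (hf.integrable_of_hasCompactSupport hfc)
    (hg.integrable_of_hasCompactSupport hgc),
    MeasureTheory.integral_sub (hf.integrable_of_hasCompactSupport hfc)
    (hg.integrable_of_hasCompactSupport hgc)]
  ring

end LocMeasure

/-! ### The duality argument -/

section Uniqueness

variable {d : ℕ}

local notation "E" => EuclideanSpace ℝ (Fin d)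

theorem integrable_integral_of_integrable_compProd {m : Measure ℝ} [SFinite m] {κ : Kernel ℝ E}
    [IsSFiniteKernel κ] {G : ℝ × E → ℝ} (hG : Integrable G (m ⊗ₘ κ)) :
    Integrable (fun t => ∫ x, G (t, x) ∂κ t) m := by
  have := Integrable.integral_compProd (κ := Kernel.const Unit m) (η := Kernel.prodMkLeft Unit κ)
    (a := ()) hG
  simpa using this

/-- The hypotheses on `b` concern `|M|` only. Fubini for the two kernels carries integrability to
almost every slice, and minimality of the Jordan parts carries it from the kernels to `|μ_t|`. -/
theorem IsGivenBy.integrable_integral {T : ℝ} {M : LocMeasure (E × Icc (0 : ℝ) T)}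
    {μ : ℝ → LocMeasure E} (h : IsGivenBy T M μ) {B : Set E} (hB : MeasurableSet B)
    (hb : Bornology.IsBounded B) {g : E → ℝ → ℝ} (hg0 : ∀ x ∉ B, ∀ t ∈ Icc 0 T, g x t = 0)
    (hg : IntegrableOn (fun p : E × Icc (0 : ℝ) T => g p.1 p.2) (B ×ˢ univ) M.variation) :
    IntegrableOn (fun t => (μ t).integral fun x => g x t) (Icc 0 T) ∧
      ∀ᵐ t ∂volume.restrict (Icc 0 T), IntegrableOn (fun x => g x t) B (μ t).variation := by
  obtain ⟨α, β, _, _, _, _, hα, hβ, hae⟩ := h.exists_kernels hB hb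
  unfold LocMeasure.variation at hg
  rw [IntegrableOn, Measure.restrict_add, integrable_add_measure] at hg
  have hGα : Integrable (fun q : ℝ × E => g q.2 q.1) (volume.restrict (Icc 0 T) ⊗ₘ α) := by
    rw [hα, (measurableEmbedding_swapTime T).integrable_map_iff]
    exact hg.1
  have hGβ : Integrable (fun q : ℝ × E => g q.2 q.1) (volume.restrict (Icc 0 T) ⊗ₘ β) := by
    rw [hβ, (measurableEmbedding_swapTime T).integrable_map_iff]
    exact hg.2
  have h1 := (Measure.integrable_compProd_iff hGα.aestronglyMeasurable).1 hGα
  have h2 := (Measure.integrable_compProd_iff hGβ.aestronglyMeasurable).1 hGβ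
  refine ⟨?_, ?_⟩
  · refine ((integrable_integral_of_integrable_compProd hGα).sub
      (integrable_integral_of_integrable_compProd hGβ)).congr ?_
    filter_upwards [hae, h1.1, h2.1, ae_restrict_mem measurableSet_Icc] with t ht hα' hβ' htT
    rw [(μ t).integral_eq_sub hB hb (measure_lt_top _ _) (measure_lt_top _ _) ht
      (fun x hx => hg0 x hx t htT) hα'.integrableOn hβ'.integrableOn,
      setIntegral_eq_integral_of_forall_compl_eq_zero (fun x hx => hg0 x hx t htT),
      setIntegral_eq_integral_of_forall_compl_eq_zero (fun x hx => hg0 x hx t htT)]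
    rfl
  · filter_upwards [hae, h1.1, h2.1] with t ht hα' hβ'
    unfold LocMeasure.variation
    rw [IntegrableOn, Measure.restrict_add, integrable_add_measure]
    exact ⟨Integrable.mono_measure hα'.integrableOn
        ((μ t).restrict_posPart_le hB hb ht),
      Integrable.mono_measure hβ'.integrableOn
        ((μ t).restrict_negPart_le hB hb ht)⟩

theorem gradient_eq_zero_of_lt_norm {u : E → ℝ} {R : ℝ} (hu : ∀ x, R < ‖x‖ → u x = 0) {x : E}
    (hx : R < ‖x‖) : gradient u x = 0 := by
  have : u =ᶠ[𝓝 x] fun _ => 0 := by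
    filter_upwards [(isOpen_lt continuous_const continuous_norm).mem_nhds hx] with y hy
    exact hu y hy
  unfold gradient
  rw [this.fderiv_eq]
  simp

/-- At the end points `0` and `T` the function vanishes on one side only, but the two-sided
derivative is determined by the derivative within `[0, T]`. -/
theorem deriv_eq_zero_of_eqOn_Icc {f : ℝ → ℝ} {T t : ℝ} (hT : 0 < T) (ht : t ∈ Icc 0 T)
    (hf : DifferentiableAt ℝ f t) (h0 : ∀ s ∈ Icc 0 T, f s = 0) : deriv f t = 0 :=
  ((uniqueDiffOn_Icc hT) t ht).eq_deriv _ hf.hasDerivAt.hasDerivWithinAt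
    ((hasDerivWithinAt_const t _ (0 : ℝ)).congr h0 (h0 t ht))

/-- The integral identity for the difference of two solutions of the same Cauchy problem. -/
theorem IsSolution.integral_sub_eq {T : ℝ} (hT : 0 < T) {b : E → ℝ → E} {ν : LocMeasure E}
    {M₁ M₂ : LocMeasure (E × Icc (0 : ℝ) T)} {μ₁ μ₂ : ℝ → LocMeasure E}
    (h₁ : IsSolution T b ν M₁ μ₁) (h₂ : IsSolution T b ν M₂ μ₂) {u : E → ℝ → ℝ}
    (hu : ContDiff ℝ 1 fun p : E × ℝ => u p.1 p.2) {R : ℝ}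
    (hR : ∀ x, ∀ t ∈ Icc 0 T, R < ‖x‖ → u x t = 0) :
    ∀ᵐ τ ∂volume.restrict (Icc 0 T), (μ₁ τ - μ₂ τ).integral (fun x => u x τ) =
      ∫ s in (0 : ℝ)..τ, (μ₁ s - μ₂ s).integral fun x =>
        deriv (u x) s + inner ℝ (b x s) (gradient (fun y => u y s) x) := by
  have htest := isTestFunction_of_contDiff (T := T) hu
    ⟨R, fun x t ht hx => hR x t (Ico_subset_Icc_self ht) hx⟩
  set B : Set E := Metric.closedBall 0 R with hBdef
  have hB : MeasurableSet B := Metric.isClosed_closedBall.measurableSet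
  have hBc : IsCompact B := isCompact_closedBall 0 R
  have hb : Bornology.IsBounded B := Metric.isBounded_closedBall
  have hnotB : ∀ x ∉ B, R < ‖x‖ := fun x hx => by simpa [hBdef] using hx
  set g : E → ℝ → ℝ := fun x s => deriv (u x) s + inner ℝ (b x s) (gradient (fun y => u y s) x)
  have hg0 : ∀ x ∉ B, ∀ t ∈ Icc 0 T, g x t = 0 := by
    intro x hx t ht
    have hx' := hnotB x hx
    simp only [g]
    rw [gradient_eq_zero_of_lt_norm (fun y hy => hR y t ht hy) hx', inner_zero_right, add_zero]
    exact deriv_eq_zero_of_eqOn_Icc hT ht (hasDerivAt_time_of_contDiff hu x t).differentiableAt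
      fun s hs => hR x s hs hx'
  have hcoe : Continuous fun p : E × Icc (0 : ℝ) T => (p.1, (p.2 : ℝ)) :=
    continuous_fst.prodMk (continuous_subtype_val.comp continuous_snd)
  have hBu : IsCompact (B ×ˢ (univ : Set (Icc (0 : ℝ) T))) := hBc.prod isCompact_univ
  have hgint : ∀ {M : LocMeasure (E × Icc (0 : ℝ) T)} {μ : ℝ → LocMeasure E},
      IsSolution T b ν M μ →
      IntegrableOn (fun p : E × Icc (0 : ℝ) T => g p.1 p.2) (B ×ˢ univ) M.variation := by
    intro M μ h
    refine Integrable.add ?_ ?_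
    · exact ((continuous_deriv_of_contDiff hu).comp hcoe).continuousOn.integrableOn_compact hBu
    · have hgc := (continuous_gradient_of_contDiff hu).comp hcoe
      obtain ⟨C, hC⟩ := hBu.exists_bound_of_continuousOn hgc.continuousOn
      have hbint : IntegrableOn (fun p : E × Icc (0 : ℝ) T => b p.1 p.2) (B ×ˢ univ)
          M.variation := (h.integrableOn 0 (R + 1)).mono_set
        (prod_mono (Metric.closedBall_subset_ball (by linarith)) Subset.rfl)
      refine Integrable.mono' (hbint.norm.mul_const C)
        (hbint.aestronglyMeasurable.inner hgc.aestronglyMeasurable) ?_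
      filter_upwards [ae_restrict_mem (hB.prod MeasurableSet.univ)] with p hp
      refine (norm_inner_le_norm _ _).trans ?_
      gcongr
      exact hC p hp
  obtain ⟨I₁, J₁⟩ := h₁.isGivenBy.integrable_integral hB hb hg0 (hgint h₁)
  obtain ⟨I₂, J₂⟩ := h₂.isGivenBy.integrable_integral hB hb hg0 (hgint h₂)
  filter_upwards [h₁.integral_eq _ _ _ htest, h₂.integral_eq _ _ _ htest,
    ae_restrict_mem measurableSet_Icc] with τ e₁ e₂ hτ
  have hsub : Ioc 0 τ ⊆ Icc 0 T := fun s hs => ⟨hs.1.le, hs.2.trans hτ.2⟩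
  have hcont : Continuous fun x => u x τ :=
    hu.continuous.comp (continuous_id.prodMk continuous_const)
  -- The common initial terms with `ν` cancel here.
  rw [LocMeasure.integral_sub _ _ hB hb (fun x hx => hR x τ hτ (hnotB x hx))
    (hcont.continuousOn.integrableOn_compact hBc) (hcont.continuousOn.integrableOn_compact hBc),
    e₁, e₂, add_sub_add_left_eq_sub, ← intervalIntegral.integral_sub
    ((intervalIntegrable_iff_integrableOn_Ioc_of_le hτ.1).2 (I₁.mono_set hsub))
    ((intervalIntegrable_iff_integrableOn_Ioc_of_le hτ.1).2 (I₂.mono_set hsub))]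
  rw [intervalIntegral.integral_of_le hτ.1, intervalIntegral.integral_of_le hτ.1]
  refine integral_congr_ae (ae_restrict_of_ae_restrict_of_subset hsub ?_)
  filter_upwards [J₁, J₂, ae_restrict_mem measurableSet_Icc] with s hs₁ hs₂ hs
  exact (LocMeasure.integral_sub _ _ hB hb (fun x hx => hg0 x hx s hs) hs₁ hs₂).symm

/-- The error term of the duality argument, for an approximating field `β` of `b`. -/
theorem enorm_integral_error_le {b β : E → ℝ → E} {r D : ℝ} (hD : 0 ≤ D) {V : E → ℝ} {u : E → ℝ → ℝ}
    {s : ℝ} (hout : ∀ x ∉ Metric.ball (0 : E) r,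
      gradient (fun y => u y s) x = 0 ∧ deriv (u x) s = 0)
    (heq : ∀ x ∈ Metric.ball (0 : E) r,
      deriv (u x) s = -inner ℝ (β x s) (gradient (fun y => u y s) x))
    (hgrad : ∀ x ∈ Metric.ball (0 : E) r, ‖gradient (fun y => u y s) x‖ ≤ D * √(V x))
    (μ : LocMeasure E) :
    ‖μ.integral fun x => deriv (u x) s + inner ℝ (b x s) (gradient (fun y => u y s) x)‖ₑ ≤
      ENNReal.ofReal D * ∫⁻ x in Metric.ball 0 r, ‖√(V x) • (β x s - b x s)‖ₑ ∂μ.variation := by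
  refine (μ.enorm_integral_le _).trans ?_
  rw [← lintegral_const_mul' _ _ ENNReal.ofReal_ne_top,
    ← lintegral_indicator Metric.isOpen_ball.measurableSet]
  refine lintegral_mono fun x => ?_
  by_cases hx : x ∈ Metric.ball (0 : E) r
  · rw [indicator_of_mem hx, heq x hx, ← ofReal_norm, ← ofReal_norm, ← ENNReal.ofReal_mul hD]
    refine ENNReal.ofReal_le_ofReal ?_
    rw [neg_add_eq_sub, ← inner_sub_left, norm_smul, Real.norm_of_nonneg (Real.sqrt_nonneg _)]
    refine (norm_inner_le_norm _ _).trans ?_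
    calc ‖b x s - β x s‖ * ‖gradient (fun y => u y s) x‖
        ≤ ‖b x s - β x s‖ * (D * √(V x)) := by gcongr; exact hgrad x hx
      _ = D * (√(V x) * ‖β x s - b x s‖) := by rw [norm_sub_rev]; ring
  · rw [indicator_of_notMem hx, (hout x hx).1, (hout x hx).2]
    simp

theorem hasCompactSupport_of_lt_norm {f : E → ℝ} {R : ℝ} (h : ∀ x, R < ‖x‖ → f x = 0) :
    HasCompactSupport f :=
  HasCompactSupport.intro (isCompact_closedBall 0 R) fun x hx => h x (by simpa using hx)

/-- The bound for the action of the difference of two solutions on `ψ` by the error of an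
approximating smooth field. -/
theorem IsSolution.enorm_integral_sub_le {T : ℝ} (hT : 0 < T) {b : E → ℝ → E} {ν : LocMeasure E}
    {M₁ M₂ : LocMeasure (E × Icc (0 : ℝ) T)} {μ₁ μ₂ : ℝ → LocMeasure E}
    (h₁ : IsSolution T b ν M₁ μ₁) (h₂ : IsSolution T b ν M₂ μ₂)
    {C₁ C₂ c R r M : ℝ} (hC₂ : 0 ≤ C₂) (hC₁ : 0 ≤ C₁)
    (hR : 0 ≤ R) (hc : 0 < c) (hM : 0 ≤ M)
    {β : E → ℝ → E} (hβ : ContDiff ℝ ∞ fun p : E × ℝ => β p.1 p.2)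
    (hgrowth : ∀ x, ∀ t ∈ Icc 0 T, ‖β x t‖ ≤ C₁ + C₁ * ‖x‖)
    (hr : gronwallBound R C₁ C₁ T < r)
    {V : E → ℝ} (hV : Differentiable ℝ V) (hVc : ∀ x ∈ Metric.ball (0 : E) r, c ≤ V x)
    (hVb : ∀ x ∈ Metric.ball (0 : E) r, ∀ t ∈ Icc 0 T,
      inner ℝ (β x t) (gradient V x) ≤ (C₂ - 2 * maxJacobianForm β x t) * V x)
    {ψ : E → ℝ} (hψ : ContDiff ℝ 1 ψ) (hψR : ∀ x, R < ‖x‖ → ψ x = 0)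
    (hψM : ∀ x, ‖fderiv ℝ ψ x‖ ≤ M) :
    ∀ᵐ τ ∂volume.restrict (Icc 0 T), ‖(μ₁ τ - μ₂ τ).integral ψ‖ₑ ≤
      ENNReal.ofReal (M * √(Real.exp (C₂ * T) / c)) * ∫⁻ t in Icc 0 T, ∫⁻ x in Metric.ball 0 r,
        ‖√(V x) • (β x t - b x t)‖ₑ ∂(μ₁ t - μ₂ t).variation := by
  obtain ⟨Λ, hΛ, h⟩ := exists_local_transport_solution hC₂ hC₁ hR hc hM hβ hgrowth hr hV hVc hVb
    hψ hψR hψM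
  have hRr : R < r := by
    refine lt_of_le_of_lt ?_ hr
    have := gronwallBound_mono hR hC₁ hC₁ hT.le
    rwa [gronwallBound_x0] at this
  set D := M * √(Real.exp (C₂ * T) / c)
  have hD : 0 ≤ D := by positivity
  set J := ∫⁻ t in Icc 0 T, ∫⁻ x in Metric.ball (0 : E) r,
        ‖√(V x) • (β x t - b x t)‖ₑ ∂(μ₁ t - μ₂ t).variation
  -- the bound for solutions of the transport equation with rational final time
  have hq : ∀ q : ℚ, ∀ᵐ τ : ℝ ∂volume.restrict (Icc 0 T), (q : ℝ) ∈ Icc 0 T → τ ≤ q →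
      ∃ f : E → ℝ, Continuous f ∧ (∀ x ∉ Metric.ball (0 : E) r, f x = 0) ∧
        (∀ x, |f x - ψ x| ≤ Λ * |q - τ|) ∧
        ‖(μ₁ τ - μ₂ τ).integral f‖ₑ ≤ ENNReal.ofReal D * J := by
    intro q
    by_cases hqT : (q : ℝ) ∈ Icc 0 T
    swap
    · exact Eventually.of_forall fun τ h => absurd h hqT
    obtain ⟨u, hu, ⟨R', hR'⟩, hout, heq, hgrad, hclose⟩ := h q hqT
    filter_upwards [h₁.integral_sub_eq hT h₂ hu hR', ae_restrict_mem measurableSet_Icc]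
      with τ hτ hτT _ hτq
    refine ⟨fun x => u x τ, hu.continuous.comp (continuous_id.prodMk continuous_const),
      fun x hx => (hout x τ ⟨hτT.1, hτq⟩ hx).1, fun x => hclose x τ, ?_⟩
    rw [hτ, intervalIntegral.integral_of_le hτT.1]
    refine (enorm_integral_le_lintegral_enorm _).trans ?_
    rw [← lintegral_const_mul' _ _ ENNReal.ofReal_ne_top]
    refine le_trans ?_ (lintegral_mono_set (show Ioc 0 τ ⊆ Icc 0 T from
      fun s hs => ⟨hs.1.le, hs.2.trans hτT.2⟩))
    refine lintegral_mono_ae ?_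
    filter_upwards [ae_restrict_mem measurableSet_Ioc] with s hs
    have hs' : s ∈ Icc 0 (q : ℝ) := ⟨hs.1.le, hs.2.trans hτq⟩
    exact enorm_integral_error_le hD (fun x hx => (hout x s hs' hx).2) (fun x hx => heq x hx s hs')
      (fun x hx => hgrad x hx s hs') _
  -- A rational final time strictly between `τ` and `T` will be needed. As the rationals are
  -- countable, one null set serves all of them.
  have hT' : ∀ᵐ τ ∂volume.restrict (Icc 0 T), τ ≠ T :=
    ae_restrict_of_ae (Measure.ae_ne volume T)
  filter_upwards [ae_all_iff.2 hq, hT', ae_restrict_mem measurableSet_Icc] with τ hτ hne hτT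
  set μ := μ₁ τ - μ₂ τ
  have hfin : μ.variation (Metric.ball (0 : E) r) ≠ ⊤ :=
    (μ.variation_lt_top Metric.isBounded_ball).ne
  refine ENNReal.le_of_forall_pos_le_add fun ε hε _ => ?_
  set m := μ.variation.real (Metric.ball (0 : E) r)
  have hm : 0 ≤ m := measureReal_nonneg
  have hδ : 0 < (ε : ℝ) / (Λ * m + 1) := by positivity
  -- With `m = |μ|(ball 0 r)`, replacing `ψ` by the solution at time `τ` costs at most `Λ (q - τ) m
  -- ≤ ε`; the `+ 1` avoids division by zero.
  obtain ⟨q, hq1, hq2⟩ := exists_rat_btwn (show τ < min T (τ + ε / (Λ * m + 1)) from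
    lt_min (lt_of_le_of_ne hτT.2 hne) (by linarith))
  obtain ⟨f, hfc, hf0, hfψ, hfJ⟩ := hτ q ⟨hτT.1.trans hq1.le, (hq2.trans_le (min_le_left _ _)).le⟩
    hq1.le
  have hcomp : HasCompactSupport f := hasCompactSupport_of_lt_norm (R := r) fun x hx =>
    hf0 x (by simpa using hx.le)
  have hψcomp : HasCompactSupport ψ := hasCompactSupport_of_lt_norm hψR
  have hψ0 : ∀ x ∉ Metric.ball (0 : E) r, ψ x = 0 := fun x hx =>
    hψR x (hRr.trans_le (by simpa using hx))
  have hdiff : ‖μ.integral fun x => ψ x - f x‖ₑ ≤ ε := by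
    refine (μ.enorm_integral_le _).trans ?_
    have hle : ∀ x, ‖ψ x - f x‖ₑ ≤ (Metric.ball (0 : E) r).indicator
        (fun _ => ENNReal.ofReal (Λ * |q - τ|)) x := by
      intro x
      by_cases hx : x ∈ Metric.ball (0 : E) r
      · rw [indicator_of_mem hx, ← ofReal_norm, norm_sub_rev]
        exact ENNReal.ofReal_le_ofReal (hfψ x)
      · rw [hf0 x hx, hψ0 x hx]
        simp
    refine (lintegral_mono hle).trans ?_
    rw [lintegral_indicator_const Metric.isOpen_ball.measurableSet, ← ENNReal.ofReal_toReal hfin,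
      ← ENNReal.ofReal_mul (by positivity), ← ENNReal.ofReal_coe_nnreal]
    refine ENNReal.ofReal_le_ofReal ?_
    change Λ * |q - τ| * m ≤ ε
    have hqτ : |q - τ| ≤ ε / (Λ * m + 1) := by
      rw [abs_of_pos (by linarith)]
      linarith [hq2.trans_le (min_le_right T _)]
    calc Λ * |q - τ| * m = (Λ * m) * |q - τ| := by ring
      _ ≤ (Λ * m + 1) * (ε / (Λ * m + 1)) := by
        gcongr
        linarith
      _ = ε := by field_simp
  have hsplit : μ.integral ψ = μ.integral f + μ.integral fun x => ψ x - f x := by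
    rw [μ.integral_sub_fun hψ.continuous hψcomp hfc hcomp]
    ring
  rw [hsplit]
  exact (enorm_add_le _ _).trans (add_le_add hfJ hdiff)

/-- A locally bounded measure is determined by the integrals of countably many smooth functions
with compact support. -/
theorem exists_countable_separating_family : ∃ ψ : ℕ → E → ℝ,
    (∀ n, ContDiff ℝ ∞ (ψ n)) ∧ (∀ n, HasCompactSupport (ψ n)) ∧
    ∀ μ : LocMeasure E, (∀ n, μ.integral (ψ n) = 0) →
      ∀ A, MeasurableSet A → Bornology.IsBounded A → μ A = 0 := by
  obtain ⟨C, hCc, hCpi, hCgen, hCo, hCu⟩ := exists_countable_isOpen_piSystem E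
  have hopen : ∀ (O : C) (m : ℕ), IsOpen ((O : Set E) ∩ Metric.ball 0 m) := fun O m =>
    (hCo O O.2).inter Metric.isOpen_ball
  have hex : ∀ (O : C) (m : ℕ), ∃ f : E → ℝ, f.support = (O : Set E) ∩ Metric.ball 0 m ∧
      ContDiff ℝ ∞ f ∧ Set.range f ⊆ Set.Icc 0 1 := fun O m =>
    (hopen O m).exists_contDiff_support_eq (n := ⊤)
  choose f hfs hfc hfr using hex
  have hcC : Countable C := hCc.to_subtype
  have hne : Nonempty (C × ℕ × ℕ) := ⟨⟨⟨univ, hCu⟩, 0, 0⟩⟩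
  obtain ⟨e, he⟩ := exists_surjective_nat (C × ℕ × ℕ)
  -- As the last index tends to infinity, these functions converge pointwise to the indicator of `{f
  -- > 0} = O ∩ ball 0 m`, while staying in `[0, 1]` and vanishing off that set.
  let Ψ : C × ℕ × ℕ → E → ℝ := fun i x => Real.smoothTransition (i.2.2 * f i.1 i.2.1 x)
  have hΨc : ∀ i, ContDiff ℝ ∞ (Ψ i) := fun i =>
    Real.smoothTransition.contDiff.comp (contDiff_const.mul (hfc _ _))
  have hΨ0 : ∀ (O : C) (m n : ℕ), ∀ x ∉ (O : Set E) ∩ Metric.ball 0 m, Ψ (O, m, n) x = 0 := by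
    intro O m n x hx
    have : f O m x = 0 := by
      rw [← hfs O m] at hx
      exact Function.notMem_support.1 hx
    simp [Ψ, this]
  have hΨs : ∀ i, HasCompactSupport (Ψ i) := fun i =>
    hasCompactSupport_of_lt_norm (R := i.2.1) fun x hx => hΨ0 i.1 i.2.1 i.2.2 x fun h => by
      have h2 := h.2
      rw [mem_ball_zero_iff] at h2
      linarith
  refine ⟨fun n => Ψ (e n), fun n => hΨc _, fun n => hΨs _, fun μ hμ A hA hb => ?_⟩
  have hμ' : ∀ i, μ.integral (Ψ i) = 0 := fun i => by
    obtain ⟨n, rfl⟩ := he i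
    exact hμ n
  have hlim : ∀ (Q : Measure E) [IsFiniteMeasureOnCompacts Q] (O : C) (m : ℕ),
      Tendsto (fun n => ∫ x, Ψ (O, m, n) x ∂Q) atTop
        (𝓝 (Q.real ((O : Set E) ∩ Metric.ball 0 m))) := by
    intro Q _ O m
    have hmeas := (hopen O m).measurableSet
    have hfin : Q ((O : Set E) ∩ Metric.ball 0 m) ≠ ⊤ :=
      ((measure_mono (inter_subset_right.trans Metric.ball_subset_closedBall)).trans_lt
        (isCompact_closedBall (0 : E) m).measure_lt_top).ne
    have e1 : Q.real ((O : Set E) ∩ Metric.ball 0 m) =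
        ∫ x, ((O : Set E) ∩ Metric.ball 0 m).indicator (fun _ => (1 : ℝ)) x ∂Q := by
      rw [integral_indicator_const _ hmeas]; simp
    rw [e1]
    refine tendsto_integral_of_dominated_convergence
      (((O : Set E) ∩ Metric.ball 0 m).indicator fun _ => (1 : ℝ))
      (fun n => (hΨc _).continuous.aestronglyMeasurable)
      ((integrable_indicator_iff hmeas).2 (integrableOn_const hfin))
      (fun n => Eventually.of_forall fun x => ?_) (Eventually.of_forall fun x => ?_)
    · by_cases hx : x ∈ (O : Set E) ∩ Metric.ball 0 m
      · rw [indicator_of_mem hx, Real.norm_of_nonneg (Real.smoothTransition.nonneg _)]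
        exact Real.smoothTransition.le_one _
      · rw [indicator_of_notMem hx, hΨ0 O m n x hx, norm_zero]
    · by_cases hx : x ∈ (O : Set E) ∩ Metric.ball 0 m
      · rw [indicator_of_mem hx]
        have hpos : 0 < f O m x := by
          have h1 : f O m x ≠ 0 := by rw [← hfs O m] at hx; exact hx
          exact lt_of_le_of_ne (hfr O m ⟨x, rfl⟩).1 h1.symm
        obtain ⟨N, hN⟩ := exists_nat_ge (1 / f O m x)
        refine tendsto_const_nhds.congr' ?_
        filter_upwards [eventually_ge_atTop N] with n hn
        refine (Real.smoothTransition.one_of_one_le ?_).symm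
        rw [div_le_iff₀ hpos] at hN
        refine hN.trans ?_
        dsimp only
        gcongr
      · rw [indicator_of_notMem hx]
        exact tendsto_const_nhds.congr fun n => (hΨ0 O m n x hx).symm
  obtain ⟨R, hR⟩ := hb.exists_norm_le
  obtain ⟨m, hm⟩ := exists_nat_gt R
  have hAm : A ⊆ Metric.ball 0 m := fun x hx => by
    rw [mem_ball_zero_iff]
    exact (hR x hx).trans_lt hm
  have hfP : IsFiniteMeasure (μ.posPart.restrict (Metric.ball 0 m)) :=
    ⟨by rw [Measure.restrict_apply_univ]; exact μ.posPart_lt_top Metric.isBounded_ball⟩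
  -- Dominated convergence for each part separately shows that `μ⁺` and `μ⁻` agree on the π-system.
  have hext : μ.posPart.restrict (Metric.ball 0 m) = μ.negPart.restrict (Metric.ball 0 m) := by
    have key : ∀ O ∈ C, μ.posPart.restrict (Metric.ball 0 m) O =
        μ.negPart.restrict (Metric.ball 0 m) O := by
      intro O hO
      have hbO : Bornology.IsBounded (O ∩ Metric.ball 0 m) :=
        Metric.isBounded_ball.subset inter_subset_right
      rw [Measure.restrict_apply (hCo O hO).measurableSet,
        Measure.restrict_apply (hCo O hO).measurableSet,
        ← ENNReal.toReal_eq_toReal_iff' (μ.posPart_lt_top hbO).ne (μ.negPart_lt_top hbO).ne]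
      refine tendsto_nhds_unique (hlim μ.posPart ⟨O, hO⟩ m) ?_
      refine (hlim μ.negPart ⟨O, hO⟩ m).congr fun n => ?_
      have := hμ' (⟨O, hO⟩, m, n)
      unfold LocMeasure.integral at this
      linarith
    exact ext_of_generate_finite C hCgen hCpi key (key univ hCu)
  have hA' := congrArg (fun Q => Q A) hext
  simp only [Measure.restrict_apply hA, inter_eq_left.2 hAm] at hA'
  rw [μ.apply_eq_sub hA hb, measureReal_def, measureReal_def, hA', sub_self]

/-- Two locally bounded measures given by almost everywhere equal families are equal. -/
theorem IsGivenBy.unique {T : ℝ} {M₁ M₂ : LocMeasure (E × Icc (0 : ℝ) T)}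
    {μ₁ μ₂ : ℝ → LocMeasure E} (h₁ : IsGivenBy T M₁ μ₁) (h₂ : IsGivenBy T M₂ μ₂)
    (h : ∀ᵐ t ∂volume.restrict (Icc 0 T), μ₁ t = μ₂ t) : M₁ = M₂ := by
  refine LocMeasure.ext fun A hA hb => ?_
  rw [h₁.apply_eq hA hb, h₂.apply_eq hA hb]
  refine integral_congr_ae ?_
  filter_upwards [h] with t ht
  rw [ht]

end Uniqueness

end ContinuityEq

/-! ### Passage to the limit in `k` -/

theorem theorem1 {d : ℕ} (T : ℝ) (hT : 0 < T)
    (b : EuclideanSpace ℝ (Fin d) → ℝ → EuclideanSpace ℝ (Fin d))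
    (ν : ContinuityEq.LocMeasure (EuclideanSpace ℝ (Fin d)))
    (M₁ M₂ : ContinuityEq.LocMeasure (EuclideanSpace ℝ (Fin d) × Set.Icc (0 : ℝ) T))
    (μ₁ μ₂ : ℝ → ContinuityEq.LocMeasure (EuclideanSpace ℝ (Fin d)))
    (h₁ : ContinuityEq.IsSolution T b ν M₁ μ₁)
    (h₂ : ContinuityEq.IsSolution T b ν M₂ μ₂)
    (H : ∃ C₁ : ℝ, 0 ≤ C₁ ∧ ∀ (z : EuclideanSpace ℝ (Fin d)) (r : ℝ), 0 < r →
      ∃ C₂ : ℝ, 0 ≤ C₂ ∧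
      ∃ bk : ℕ → EuclideanSpace ℝ (Fin d) → ℝ → EuclideanSpace ℝ (Fin d),
      ∃ V : ℕ → EuclideanSpace ℝ (Fin d) → ℝ,
        (∀ k, ContDiff ℝ ∞ (fun p : EuclideanSpace ℝ (Fin d) × ℝ => bk k p.1 p.2)) ∧
        (∀ k, ContDiff ℝ 1 (V k)) ∧
        (∀ k x, 0 < V k x) ∧
        (∀ k x, ∀ t ∈ Set.Icc 0 T, ‖bk k x t‖ ≤ C₁ + C₁ * ‖x‖) ∧
        (∃ c : ℝ, 0 < c ∧ ∀ k, ∀ x ∈ Metric.ball z r, c ≤ V k x) ∧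
        (∀ k, ∀ x ∈ Metric.ball z r, ∀ t ∈ Set.Icc 0 T,
          inner ℝ (bk k x t) (gradient (V k) x) ≤
            (C₂ - 2 * ContinuityEq.maxJacobianForm (bk k) x t) * V k x) ∧
        Filter.Tendsto
          (fun k => ∫⁻ t in Set.Icc 0 T, ∫⁻ x in Metric.ball z r,
            ‖Real.sqrt (V k x) • (bk k x t - b x t)‖ₑ ∂(μ₁ t - μ₂ t).variation)
          Filter.atTop (nhds 0)) :
    M₁ = M₂ ∧ ∀ᵐ t ∂(MeasureTheory.volume.restrict (Set.Icc 0 T)), μ₁ t = μ₂ t := by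
  obtain ⟨C₁, hC₁, H⟩ := H
  have hψ0 : ∀ ψ : EuclideanSpace ℝ (Fin d) → ℝ, ContDiff ℝ ∞ ψ → HasCompactSupport ψ →
      ∀ᵐ τ ∂volume.restrict (Icc 0 T), (μ₁ τ - μ₂ τ).integral ψ = 0 := by
    intro ψ hψ hψc
    obtain ⟨R, hRpos, hR⟩ : ∃ R : ℝ, 0 < R ∧ ∀ x, R < ‖x‖ → ψ x = 0 := by
      obtain ⟨R, hRpos, hR⟩ := hψc.isCompact.isBounded.exists_pos_norm_le
      exact ⟨R, hRpos, fun x hx => image_eq_zero_of_notMem_tsupport fun h =>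
        absurd (hR x h) (not_le.2 hx)⟩
    obtain ⟨L, hL⟩ := (hψc.fderiv ℝ).exists_bound_of_continuous
      (hψ.continuous_fderiv (by simp))
    have hL0 : 0 ≤ L := (norm_nonneg _).trans (hL 0)
    have hrpos : 0 ≤ gronwallBound R C₁ C₁ T := by
      have := gronwallBound_mono hRpos.le hC₁ hC₁ hT.le
      rw [gronwallBound_x0] at this
      linarith
    -- The ball is chosen from `R`, `C₁` and `T` alone, so it works for all `k`; the `+ 1` gives the
    -- strict inequality that keeps trajectories in the open ball.
    obtain ⟨C₂, hC₂, bk, V, hbk, hV, -, hgrowth, ⟨c, hc, hVc⟩, hVb, hlim⟩ :=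
      H 0 (gronwallBound R C₁ C₁ T + 1) (by linarith)
    have hk : ∀ᵐ τ ∂volume.restrict (Icc 0 T), ∀ k, _ := ae_all_iff.2 fun k =>
      h₁.enorm_integral_sub_le hT h₂ hC₂ hC₁ hRpos.le hc hL0 (hbk k) (hgrowth k)
        (lt_add_one _) ((hV k).differentiable one_ne_zero) (hVc k) (hVb k)
        (hψ.of_le (by exact_mod_cast le_top)) hR hL
    filter_upwards [hk] with τ hτ
    have hlim' := ENNReal.Tendsto.const_mul (a := ENNReal.ofReal (L * √(Real.exp (C₂ * T) / c)))
      hlim (Or.inr ENNReal.ofReal_ne_top)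
    rw [mul_zero] at hlim'
    have := ge_of_tendsto' hlim' hτ
    simpa using this
  obtain ⟨ψ, hψ, hψc, hsep⟩ := ContinuityEq.exists_countable_separating_family (d := d)
  -- The null set depends on `ψ`, so only countably many test functions, sufficient to separate
  -- measures, are used.
  have hae : ∀ᵐ t ∂(MeasureTheory.volume.restrict (Set.Icc 0 T)), μ₁ t = μ₂ t := by
    filter_upwards [ae_all_iff.2 fun n => hψ0 (ψ n) (hψ n) (hψc n)] with t ht
    refine ContinuityEq.LocMeasure.ext fun A hA hb => ?_
    have := hsep _ ht A hA hb
    rw [ContinuityEq.LocMeasure.sub_apply] at this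
    linarith
  exact ⟨h₁.isGivenBy.unique h₂.isGivenBy hae, hae⟩
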